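/- Let $d\ge 3$ and let $p,q\in(1,\infty)$ satisfy $\frac1p-\frac1q=\frac2d$. Let $\mathbb S^{d-1}$ be the unit sphere of $\mathbb R^d$ with surface measure, and for $n\ge 0$ let $H_n^{d-1}$ be the orthogonal projection of $L^2(\mathbb S^{d-1})$ onto the space of spherical harmonics of degree $n$, that is, the restrictions to $\mathbb S^{d-1}$ of the harmonic homogeneous polynomials of degree $n$ on $\mathbb R^d$. Suppose that there is a constant $A$, independent of $n$ and $f$, such that $$\|H_n^{d-1}f\|_{L^q(\mathbb S^{d-1})}\le A\,n^{1-\frac2d}\,\|f\|_{L^p(\mathbb S^{d-1})}\qquad\text{for all } n\ge 1 \text{ and all complex-valued } f\in L^2(\mathbb S^{d-1})\cap L^p(\mathbb S^{d-1}).$$ Then for every $c>0$ there is a constant $C>0$ such that, for every $\tau\in\mathbb R$ with $\operatorname{dist}\big(\tau,\mathbb Z+\frac dq\big)\ge c$, the Carleman inequality $$\big\||x|^{-\tau}u\big\|_{L^q(\mathbb R^d)}\le C\,\big\||x|^{-\tau}\Delta u\big\|_{L^p(\mathbb R^d)}$$ holds for every complex-valued $u\in C_c^\infty(\mathbb R^d\setminus\{0\})$.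 In particular, $C$ does not depend on $\tau$ or $u$. -/

import Mathlib

open MeasureTheory

noncomputable section

/-- The unit sphere of `ℝ^d`, i.e. `𝕊^(d-1)`. -/
abbrev USphere (d : ℕ) : Type := Metric.sphere (0 : EuclideanSpace ℝ (Fin d)) 1

/-- The (unnormalized) surface measure of the unit sphere of `ℝ^d`. -/
abbrev surfaceMeasure (d : ℕ) : Measure (USphere d) :=
  (volume : Measure (EuclideanSpace ℝ (Fin d))).toSphere

/-- The Laplacian `∑ i, ∂ᵢ²` on complex polynomials in `d` variables. -/
def polyLaplacian (d : ℕ) : MvPolynomial (Fin d) ℂ →ₗ[ℂ] MvPolynomial (Fin d) ℂ :=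
  ∑ i, (MvPolynomial.pderiv i).toLinearMap ∘ₗ (MvPolynomial.pderiv i).toLinearMap

/-- The solid harmonics of degree `n`: homogeneous polynomials of degree `n` in `d` variables
that are annihilated by the Laplacian. -/
def solidHarmonics (d n : ℕ) : Submodule ℂ (MvPolynomial (Fin d) ℂ) :=
  MvPolynomial.homogeneousSubmodule (Fin d) ℂ n ⊓ LinearMap.ker (polyLaplacian d)

/-- The `i`-th coordinate as a complex-valued continuous function on the unit sphere. -/
def sphereCoord (d : ℕ) (i : Fin d) : C(USphere d, ℂ) where
  toFun x := ((x : EuclideanSpace ℝ (Fin d)) i : ℂ)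
  continuous_toFun := by fun_prop

/-- Restriction of a polynomial to the unit sphere. -/
def restrictToSphere (d : ℕ) : MvPolynomial (Fin d) ℂ →ₐ[ℂ] C(USphere d, ℂ) :=
  MvPolynomial.aeval (sphereCoord d)

/-- The space of spherical harmonics of degree `n` on the unit sphere of `ℝ^d`, as a subspace of
`L²`: restrictions to the sphere of the solid harmonics of degree `n`. -/
def sphericalHarmonics (d n : ℕ) : Submodule ℂ (Lp ℂ 2 (surfaceMeasure d)) :=
  (solidHarmonics d n).map
    ((ContinuousMap.toLp (E := ℂ) 2 (surfaceMeasure d) ℂ).toLinearMap ∘ₗ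
      (restrictToSphere d).toLinearMap)

instance instFiniteDimensionalSphericalHarmonics (d n : ℕ) :
    FiniteDimensional ℂ (sphericalHarmonics d n) := by
  have h1 : Module.Finite ℂ (MvPolynomial.homogeneousSubmodule (Fin d) ℂ n) :=
    Module.Finite.iff_fg.mpr (MvPolynomial.homogeneousSubmodule_fg (Fin d) ℂ n)
  have h2 : Module.Finite ℂ (solidHarmonics d n) :=
    Submodule.finiteDimensional_of_le
      (inf_le_left : solidHarmonics d n ≤ MvPolynomial.homogeneousSubmodule (Fin d) ℂ n)
  exact Module.Finite.map (solidHarmonics d n) _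

/-- The spherical harmonic projection: the orthogonal projection of `L²` of the unit sphere
of `ℝ^d` onto the spherical harmonics of degree `n`. -/
def harmonicProj (d n : ℕ) :
    Lp ℂ 2 (surfaceMeasure d) →L[ℂ] Lp ℂ 2 (surfaceMeasure d) :=
  (sphericalHarmonics d n).starProjection

/-- The bound `‖H_n f‖_q ≤ A * n^(1 - 2/d) * ‖f‖_p` on the unit sphere of `ℝ^d`, with a constant
`A` independent of `n ≥ 1` and of `f`. It is imposed on the dense class `L² ∩ L^p` of `L^p`, on
which the `L²` projection `H_n` is defined. -/
def HarmonicProjBound (d : ℕ) (p q : ℝ) : Prop :=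
  ∃ A : ℝ, ∀ n : ℕ, 1 ≤ n → ∀ f : Lp ℂ 2 (surfaceMeasure d),
    MemLp f (ENNReal.ofReal p) (surfaceMeasure d) →
      eLpNorm (harmonicProj d n f) (ENNReal.ofReal q) (surfaceMeasure d) ≤
        ENNReal.ofReal (A * (n : ℝ) ^ (1 - 2 / (d : ℝ))) *
          eLpNorm f (ENNReal.ofReal p) (surfaceMeasure d)

/-- The Carleman inequality `‖|x|^(-τ) u‖_q ≤ C * ‖|x|^(-τ) Δ u‖_p` on `ℝ^d` for all smooth
complex-valued `u` with compact support contained in `ℝ^d \ {0}`. -/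
def CarlemanEstimate (d : ℕ) (p q τ C : ℝ) : Prop :=
  ∀ u : EuclideanSpace ℝ (Fin d) → ℂ,
    ContDiff ℝ (⊤ : ℕ∞) u → HasCompactSupport u → (0 : EuclideanSpace ℝ (Fin d)) ∉ tsupport u →
      eLpNorm (fun x => (‖x‖ ^ (-τ) : ℝ) • u x) (ENNReal.ofReal q) volume ≤
        ENNReal.ofReal C *
          eLpNorm (fun x => (‖x‖ ^ (-τ) : ℝ) • Laplacian.laplacian u x) (ENNReal.ofReal p) volume

end

noncomputable section

/-! In logarithmic polar coordinates x = e^t ω the weighted norms become mixed norms on ℝ × 𝕊^(d-1).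
With σ = τ - d/q, the Jacobian turns |x|^(-τ) u in L^q into v = e^(-σt) u(e^t ω); since d/p = d/q +
2, it turns |x|^(-τ) Δu in L^p into g = e^(-σt) r² Δu with r = e^t (`eLpNorm_weighted_eq`). On
spherical harmonics of degree n, r²Δ is ∂² + (d-2)∂ - n(n+d-2), and conjugation by the weight
factors it as (∂ + σ - n)(∂ + σ + n + d - 2). The hypothesis on τ keeps both constants at distance
at least c from 0, so the factors can be inverted by an explicit Green kernel decaying exponentially
at both ends (`integral_mul_polyFun_eq_greenKernel`).

That kernel is at most (e^(-|σ-n||t|) + e^(-|σ+n+d-2||t|)) / (2n+d-2). The division gains a power of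
n, so against the assumed growth n^(1-2/d) of the projections there remains a sum of n^(-2/d) times
exponentials. It is bounded by a multiple of |t|^(2/d-1), uniformly in σ (`sum_greenKernel_le`).
Hence ‖v(t)‖_q is dominated by a Riesz potential of ‖g(s)‖_p (`exists_bound_weightedDilate`), and
since 1/p - 1/q = 2/d the one-dimensional Hardy–Littlewood–Sobolev inequality `hls` concludes.

Summing over n requires completeness and orthogonality of the harmonics (`hasSum_harmonicProj`). The
eigenvalue identity for the spherical Laplacian comes from Green's identity `sphere_green`, proved
with infinitesimal rotations. -/

/-! ### The Hardy–Littlewood–Sobolev inequality on the line. -/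

theorem lintegral_comp_abs_eq (f : ℝ → ENNReal) :
    ∫⁻ x, f |x| = 2 * ∫⁻ x in Set.Ioi (0 : ℝ), f x := by
  have h1 : ∫⁻ x in Set.Ioi (0 : ℝ), f |x| = ∫⁻ x in Set.Ioi (0 : ℝ), f x :=
    setLIntegral_congr_fun measurableSet_Ioi fun x hx => by
      simp only [abs_of_pos (Set.mem_Ioi.mp hx)]
  have h2 : ∫⁻ x in Set.Iio (0 : ℝ), f |x| = ∫⁻ x in Set.Ioi (0 : ℝ), f |x| := by
    have := (Measure.measurePreserving_neg (volume : Measure ℝ)).setLIntegral_comp_preimage_emb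
      (MeasurableEquiv.neg ℝ).measurableEmbedding (fun x => f |x|) (Set.Ioi 0)
    simpa using this
  rw [← lintegral_add_compl _ (measurableSet_Ioi (a := (0 : ℝ))), Set.compl_Ioi,
    setLIntegral_congr Iio_ae_eq_Iic.symm, h2, h1, two_mul]

theorem lintegral_comp_abs_sub_eq (f : ℝ → ENNReal) (t : ℝ) :
    ∫⁻ s, f |t - s| = 2 * ∫⁻ x in Set.Ioi (0 : ℝ), f x := by
  rw [lintegral_sub_left_eq_self (fun x => f |x|) t, lintegral_comp_abs_eq]

theorem lintegral_rpow_Ioc {a R : ℝ} (ha : 0 < a) (hR : 0 ≤ R) :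
    ∫⁻ x in Set.Ioc 0 R, ENNReal.ofReal (x ^ (a - 1)) = ENNReal.ofReal (R ^ a / a) := by
  rw [← ofReal_integral_eq_lintegral_ofReal, ← intervalIntegral.integral_of_le hR,
    integral_rpow (Or.inl (by linarith))]
  · simp [Real.zero_rpow ha.ne']
  · exact (intervalIntegral.intervalIntegrable_rpow' (by linarith)).1
  · filter_upwards [ae_restrict_mem measurableSet_Ioc] with x hx
    exact Real.rpow_nonneg hx.1.le _

theorem lintegral_rpow_Ioi {a R : ℝ} (ha : a < -1) (hR : 0 < R) :
    ∫⁻ x in Set.Ioi R, ENNReal.ofReal (x ^ a) = ENNReal.ofReal (R ^ (a + 1) / (-(a + 1))) := by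
  rw [← ofReal_integral_eq_lintegral_ofReal, integral_Ioi_rpow_of_lt ha hR]
  · congr 1
    rw [neg_div, div_neg]
  · exact integrableOn_Ioi_rpow_of_lt ha hR
  · filter_upwards [ae_restrict_mem measurableSet_Ioi] with x hx
    exact Real.rpow_nonneg (hR.trans hx).le _

/-- The integral of the singular part `|t - s| ≤ R` of the Riesz kernel. -/
theorem lintegral_riesz_near {β R : ℝ} (hβ : 0 < β) (hR : 0 ≤ R) (t : ℝ) :
    ∫⁻ s, (Set.Iic R).indicator (fun x => ENNReal.ofReal (x ^ (β - 1))) |t - s| =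
      ENNReal.ofReal (2 * R ^ β / β) := by
  rw [lintegral_comp_abs_sub_eq, lintegral_indicator measurableSet_Iic,
    Measure.restrict_restrict measurableSet_Iic, Set.inter_comm, Set.Ioi_inter_Iic,
    lintegral_rpow_Ioc hβ hR, mul_div_assoc, ENNReal.ofReal_mul (by norm_num)]
  simp

/-- Hölder bound for the tail `|t - s| > R` of the Riesz potential. -/
theorem riesz_tail_le {p β R : ℝ} (hp : 1 < p) (hβp : β < 1 / p) (hR : 0 < R)
    {f : ℝ → ENNReal} (hf : Measurable f) (hf1 : ∫⁻ s, f s ^ p ≤ 1) (t : ℝ) :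
    ∫⁻ s, (Set.Ioi R).indicator (fun x => ENNReal.ofReal (x ^ (β - 1))) |t - s| * f s ≤
      ENNReal.ofReal ((2 / ((1 - β) * p.conjExponent - 1)) ^ (1 / p.conjExponent) *
        R ^ (β - 1 / p)) := by
  have hpq : p.HolderConjugate p.conjExponent := Real.HolderConjugate.conjExponent hp
  set r := p.conjExponent with hr
  have hr0 : 0 < r := hpq.symm.pos
  have hinv : 1 / p + 1 / r = 1 := by simpa using hpq.inv_add_inv_eq_one
  -- This is β < 1/p rewritten: it makes the kernel's r-th power integrable at infinity.
  have hpos : 0 < (1 - β) * r - 1 := by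
    have : 1 / r < 1 - β := by linarith
    rw [div_lt_iff₀ hr0] at this
    linarith
  have hm : Measurable fun s => (Set.Ioi R).indicator
      (fun x => ENNReal.ofReal (x ^ (β - 1))) |t - s| := by
    refine Measurable.comp (Measurable.indicator (by fun_prop) measurableSet_Ioi) (by fun_prop)
  have hH := ENNReal.lintegral_mul_le_Lp_mul_Lq volume hpq.symm hm.aemeasurable hf.aemeasurable
  refine hH.trans ?_
  have h1 : ∫⁻ s, (Set.Ioi R).indicator (fun x => ENNReal.ofReal (x ^ (β - 1))) |t - s| ^ r =
      ENNReal.ofReal (2 * (R ^ ((β - 1) * r + 1) / ((1 - β) * r - 1))) := by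
    have : ∀ x : ℝ, (Set.Ioi R).indicator (fun x => ENNReal.ofReal (x ^ (β - 1))) x ^ r =
        (Set.Ioi R).indicator (fun x => ENNReal.ofReal (x ^ ((β - 1) * r))) x := by
      intro x
      by_cases hx : x ∈ Set.Ioi R
      · have hx0 : 0 < x := hR.trans hx
        rw [Set.indicator_of_mem hx, Set.indicator_of_mem hx,
          ENNReal.ofReal_rpow_of_pos (Real.rpow_pos_of_pos hx0 _), Real.rpow_mul hx0.le]
      · simp [Set.indicator_of_notMem hx, hr0]
    simp_rw [this]
    rw [lintegral_comp_abs_sub_eq, lintegral_indicator measurableSet_Ioi,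
      Measure.restrict_restrict measurableSet_Ioi,
      Set.inter_eq_left.mpr (Set.Ioi_subset_Ioi hR.le), lintegral_rpow_Ioi (by nlinarith) hR,
      ENNReal.ofReal_mul (by norm_num)]
    simp only [ENNReal.ofReal_ofNat]
    congr 3
    ring
  rw [h1]
  calc _ ≤ ENNReal.ofReal (2 * (R ^ ((β - 1) * r + 1) / ((1 - β) * r - 1))) ^ (1 / r) * 1 := by
        gcongr
        exact ENNReal.rpow_le_one hf1 (by positivity)
    _ = _ := by
      have hRp : 0 < R ^ ((β - 1) * r + 1) := Real.rpow_pos_of_pos hR _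
      rw [mul_one, ENNReal.ofReal_rpow_of_pos (by positivity)]
      congr 1
      rw [show 2 * (R ^ ((β - 1) * r + 1) / ((1 - β) * r - 1)) =
        2 / ((1 - β) * r - 1) * R ^ ((β - 1) * r + 1) by ring,
        Real.mul_rpow (by positivity) hRp.le, ← Real.rpow_mul hR.le]
      congr 2
      have : 1 / r = 1 - 1 / p := by linarith
      field_simp at this ⊢
      linarith

/-- Level-set form of the Hardy–Littlewood–Sobolev inequality: split the kernel at a radius `R`
depending on the level `l`, and the function at a height `m`. -/
theorem riesz_level_le {β R l m B : ℝ} (hβ : 0 < β) (hR : 0 < R) (hl : 0 < l) (hm : 0 ≤ m)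
    {f : ℝ → ENNReal} (hf : Measurable f)
    (htail : ∀ t, ∫⁻ s, (Set.Ioi R).indicator (fun x => ENNReal.ofReal (x ^ (β - 1))) |t - s| * f s
      ≤ ENNReal.ofReal B)
    (hB : 0 ≤ B) (hBl : B + 2 * R ^ β / β * m ≤ l / 2)
    {F : ℝ → ℝ}
    (hFle : ∀ t, ENNReal.ofReal (F t) ≤ ∫⁻ s, ENNReal.ofReal (|t - s| ^ (β - 1)) * f s) :
    volume {t | l < F t} ≤ ENNReal.ofReal (4 * R ^ β / (β * l)) *
      ∫⁻ s, {s | ENNReal.ofReal m < f s}.indicator f s := by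
  set N : ℝ → ENNReal := (Set.Iic R).indicator (fun x => ENNReal.ofReal (x ^ (β - 1))) with hN
  set T : ℝ → ENNReal := (Set.Ioi R).indicator (fun x => ENNReal.ofReal (x ^ (β - 1))) with hT
  set g := {s | ENNReal.ofReal m < f s}.indicator f with hg
  have hgm : Measurable g := hf.indicator (measurableSet_lt measurable_const hf)
  have hNm : Measurable N := Measurable.indicator (by fun_prop) measurableSet_Iic
  have hTm : Measurable T := Measurable.indicator (by fun_prop) measurableSet_Ioi
  have hRβ : 0 < R ^ β := Real.rpow_pos_of_pos hR _
  set W : ℝ → ENNReal := fun t => ∫⁻ s, N |t - s| * g s with hW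
  have hker : ∀ x : ℝ, ENNReal.ofReal (x ^ (β - 1)) = N x + T x := by
    intro x
    rcases le_or_gt x R with hx | hx
    · simp [N, T, hx]
    · simp [N, T, hx]
  have hfle : ∀ s, f s ≤ ENNReal.ofReal m + g s := by
    intro s
    by_cases hs : ENNReal.ofReal m < f s
    · simp [g, hs]
    · exact le_add_right (not_lt.mp hs)
  -- The far kernel and the part of f below height m together account for at most l/2, so the near
  -- kernel acting on the high part must supply the other half. Chebyshev and Tonelli then bound the
  -- measure.
  have hlev : ∀ t, l < F t → ENNReal.ofReal (l / 2) ≤ W t := by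
    intro t ht
    have hNt : Measurable fun s => N |t - s| := hNm.comp (by fun_prop)
    have hTt : Measurable fun s => T |t - s| := hTm.comp (by fun_prop)
    have h1 : ENNReal.ofReal l ≤ ENNReal.ofReal (l / 2) + W t := by
      calc ENNReal.ofReal l ≤ ENNReal.ofReal (F t) := ENNReal.ofReal_le_ofReal ht.le
        _ ≤ _ := hFle t
        _ = ∫⁻ s, N |t - s| * f s + T |t - s| * f s := by simp_rw [hker, add_mul]
        _ ≤ ∫⁻ s, (N |t - s| * ENNReal.ofReal m + N |t - s| * g s) + T |t - s| * f s := by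
            refine lintegral_mono fun s => ?_
            rw [← mul_add]
            gcongr
            exact hfle s
        _ = (∫⁻ s, N |t - s|) * ENNReal.ofReal m + W t + ∫⁻ s, T |t - s| * f s := by
            have h2 : Measurable fun s => T |t - s| * f s := hTt.mul hf
            have h3 : Measurable fun s => N |t - s| * g s := hNt.mul hgm
            rw [lintegral_add_right _ h2, lintegral_add_right _ h3, lintegral_mul_const _ hNt]
        _ ≤ ENNReal.ofReal (2 * R ^ β / β) * ENNReal.ofReal m + W t + ENNReal.ofReal B := by
            rw [lintegral_riesz_near hβ hR.le t]
            gcongr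
            exact htail t
        _ = ENNReal.ofReal (B + 2 * R ^ β / β * m) + W t := by
            rw [ENNReal.ofReal_add hB (by positivity), ENNReal.ofReal_mul (by positivity)]
            ring
        _ ≤ _ := by gcongr
    rw [show ENNReal.ofReal l = ENNReal.ofReal (l / 2) + ENNReal.ofReal (l / 2) by
      rw [← ENNReal.ofReal_add (by positivity) (by positivity), add_halves]] at h1
    exact (ENNReal.add_le_add_iff_left ENNReal.ofReal_ne_top).mp h1
  have hker2 : Measurable (Function.uncurry fun t s => N |t - s| * g s) := by
    have h1 : Measurable fun x : ℝ × ℝ => N |x.1 - x.2| := hNm.comp (by fun_prop)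
    exact h1.mul (hgm.comp measurable_snd)
  have hWm : Measurable W := hker2.lintegral_prod_right'
  have hWint : ∫⁻ t, W t = ENNReal.ofReal (2 * R ^ β / β) * ∫⁻ s, g s := by
    rw [lintegral_lintegral_swap hker2.aemeasurable, ← lintegral_const_mul _ hgm]
    refine lintegral_congr fun s => ?_
    have h2 : Measurable fun t => N |t - s| := hNm.comp (by fun_prop)
    rw [lintegral_mul_const _ h2]
    simp_rw [abs_sub_comm _ s]
    rw [lintegral_riesz_near hβ hR.le s]
  have hcheb := mul_meas_ge_le_lintegral hWm (ENNReal.ofReal (l / 2)) (μ := volume)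
  rw [hWint] at hcheb
  calc volume {t | l < F t} ≤ volume {t | ENNReal.ofReal (l / 2) ≤ W t} :=
        measure_mono fun t ht => hlev t ht
    _ = ENNReal.ofReal (2 / l) * (ENNReal.ofReal (l / 2) *
          volume {t | ENNReal.ofReal (l / 2) ≤ W t}) := by
        rw [← mul_assoc, ← ENNReal.ofReal_mul (by positivity),
          show 2 / l * (l / 2) = 1 by field_simp]
        simp
    _ ≤ ENNReal.ofReal (2 / l) * (ENNReal.ofReal (2 * R ^ β / β) * ∫⁻ s, g s) := by gcongr
    _ = _ := by
        rw [← mul_assoc, ← ENNReal.ofReal_mul (by positivity)]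
        congr 2
        field_simp
        norm_num

/-- Layer-cake argument. The radius and height are tuned to each level l, the level-set bound is
integrated against l^(q-1), and the order of integration is exchanged. For fixed s the l-integral
runs only up to a power of f s and yields a multiple of (f s)^(p-1), which together with the
remaining factor f s gives (f s)^p. -/
theorem hls_normalized {p q β : ℝ} (hp : 1 < p) (hq : 0 < q) (hβ : 0 < β)
    (hpq : 1 / p - 1 / q = β) : ∃ C : ℝ, 0 < C ∧ ∀ f : ℝ → ℝ, (∀ s, 0 ≤ f s) → Measurable f →
      ∫⁻ s, ENNReal.ofReal (f s ^ p) ≤ 1 → ∀ F : ℝ → ℝ, (∀ t, 0 ≤ F t) → Measurable F →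
      (∀ t, ENNReal.ofReal (F t) ≤
        ∫⁻ s, ENNReal.ofReal (|t - s| ^ (β - 1)) * ENNReal.ofReal (f s)) →
      ∫⁻ t, ENNReal.ofReal (F t ^ q) ≤ ENNReal.ofReal C := by
  have hp0 : 0 < p := by linarith
  have hβp : β < 1 / p := by
    have : 0 < 1 / q := by positivity
    linarith
  have hconj : p.HolderConjugate p.conjExponent := Real.HolderConjugate.conjExponent hp
  have hinv : 1 / p + 1 / p.conjExponent = 1 := by simpa using hconj.inv_add_inv_eq_one
  have hr0 := hconj.symm.pos
  have hpos : 0 < (1 - β) * p.conjExponent - 1 := by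
    have : 1 / p.conjExponent < 1 - β := by linarith
    rw [div_lt_iff₀ hr0] at this
    linarith
  set C₁ := (2 / ((1 - β) * p.conjExponent - 1)) ^ (1 / p.conjExponent) with hC₁
  have hC₁0 : 0 < C₁ := by positivity
  -- the radius and the height at level `l`
  set R : ℝ → ℝ := fun l => (l / (4 * C₁)) ^ (-q) with hRdef
  set K := (4 * C₁) ^ (q * β) with hK
  have hK0 : 0 < K := by positivity
  have hqβ : 1 + q * β = q / p := by
    rw [← hpq]
    field_simp
    ring
  have hRβ : ∀ l, 0 < l → R l ^ β = K * l ^ (-(q * β)) := by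
    intro l hl
    rw [hRdef, ← Real.rpow_mul (by positivity), Real.div_rpow hl.le (by positivity), hK,
      neg_mul, Real.rpow_neg (by positivity : 0 ≤ 4 * C₁), div_inv_eq_mul, mul_comm]
  -- Since β - 1/p = -1/q, the choice of `R` makes the Hölder tail exactly l/4.
  have hRtail : ∀ l, 0 < l → C₁ * R l ^ (β - 1 / p) = l / 4 := by
    intro l hl
    rw [hRdef, ← Real.rpow_mul (by positivity), show -q * (β - 1 / p) = 1 by
      rw [← hpq]; field_simp; ring, Real.rpow_one]
    field_simp
  -- With this constant the near kernel acting on heights below c l^(q/p) contributes the other l/4.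
  set c := β / (8 * K) with hc
  have hc0 : 0 < c := by positivity
  set θ := q - q / p with hθ
  have hθ0 : 0 < θ := by
    have : q / p < q := by
      rw [div_lt_iff₀ hp0]
      nlinarith
    simp only [hθ]; linarith
  refine ⟨q * (4 * K / β) * (c ^ (1 - p) / θ), by positivity, ?_⟩
  intro f hf0 hfm hf1 F hF0 hFm hFle
  have hfm' : Measurable fun s => ENNReal.ofReal (f s) := hfm.ennreal_ofReal
  have hf1' : ∫⁻ s, ENNReal.ofReal (f s) ^ p ≤ 1 := by
    simpa only [ENNReal.ofReal_rpow_of_nonneg (hf0 _) hp0.le] using hf1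
  have hlevel : ∀ l ∈ Set.Ioi (0 : ℝ), volume {t | l < F t} * ENNReal.ofReal (l ^ (q - 1)) ≤
      ENNReal.ofReal (4 * K / β) * ∫⁻ s, ENNReal.ofReal (l ^ (θ - 1)) *
        {s | c * l ^ (q / p) < f s}.indicator (fun s => ENNReal.ofReal (f s)) s := by
    intro l hl
    have hl : 0 < l := hl
    have hR0 : 0 < R l := by simp only [hRdef]; positivity
    have hm0 : 0 ≤ c * l ^ (q / p) := by positivity
    have hsum : l / 4 + 2 * R l ^ β / β * (c * l ^ (q / p)) ≤ l / 2 := by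
      rw [hRβ l hl, ← hqβ, Real.rpow_add hl, Real.rpow_one, hc, Real.rpow_neg hl.le]
      have : 0 < l ^ (q * β) := by positivity
      apply le_of_eq
      field_simp
      norm_num
    have h := riesz_level_le hβ hR0 hl hm0 hfm'
      (fun t => by
        refine (riesz_tail_le hp hβp hR0 hfm' hf1' t).trans (le_of_eq ?_)
        rw [← hC₁, hRtail l hl]) (by positivity) hsum hFle
    have hset : {s | ENNReal.ofReal (c * l ^ (q / p)) < ENNReal.ofReal (f s)} =
        {s | c * l ^ (q / p) < f s} := by
      ext s
      simp only [Set.mem_ofPred_eq, ENNReal.ofReal_lt_ofReal_iff']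
      exact ⟨fun h => h.1, fun h => ⟨h, hm0.trans_lt h⟩⟩
    rw [hset] at h
    calc _ ≤ _ := mul_le_mul_left h _
      _ = ENNReal.ofReal (4 * R l ^ β / (β * l)) * ENNReal.ofReal (l ^ (q - 1)) * _ := by
        rw [mul_right_comm]
      _ = _ := by
        rw [lintegral_const_mul, ← mul_assoc, ← ENNReal.ofReal_mul (by positivity),
          ← ENNReal.ofReal_mul (by positivity)]
        · congr 2
          rw [hRβ l hl, hθ, ← hqβ, show q - (1 + q * β) - 1 = (q - 1) + -(q * β) + -1 by ring,
            Real.rpow_add hl, Real.rpow_add hl, Real.rpow_neg_one]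
          field_simp
        · exact hfm'.indicator (measurableSet_lt measurable_const hfm)
  rw [lintegral_rpow_eq_lintegral_meas_lt_mul volume (Filter.Eventually.of_forall hF0)
    hFm.aemeasurable hq]
  have hjoint : Measurable (Function.uncurry fun l s => ENNReal.ofReal (l ^ (θ - 1)) *
        {s | c * l ^ (q / p) < f s}.indicator (fun s => ENNReal.ofReal (f s)) s) := by
    have h1 : Measurable ({x : ℝ × ℝ | c * x.1 ^ (q / p) < f x.2}.indicator
        (fun x => ENNReal.ofReal (f x.2))) :=
      (hfm'.comp measurable_snd).indicator
        (measurableSet_lt (by fun_prop) (hfm.comp measurable_snd))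
    have h2 : Measurable fun x : ℝ × ℝ => ENNReal.ofReal (x.1 ^ (θ - 1)) := by fun_prop
    exact h2.mul h1
  have hinner : ∀ s, ∫⁻ l in Set.Ioi (0 : ℝ), ENNReal.ofReal (l ^ (θ - 1)) *
        {s | c * l ^ (q / p) < f s}.indicator (fun s => ENNReal.ofReal (f s)) s ≤
      ENNReal.ofReal (c ^ (1 - p) / θ) * ENNReal.ofReal (f s ^ p) := by
    intro s
    rcases (hf0 s).eq_or_lt with h0 | hfs
    · refine le_of_eq_of_le ?_ zero_le
      rw [← lintegral_zero]
      congr 1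
      ext l
      by_cases h : c * l ^ (q / p) < f s <;> simp [← h0]
    set b := (f s / c) ^ (p / q) with hb
    calc _ ≤ ∫⁻ l in Set.Ioi (0 : ℝ), (Set.Ioc 0 b).indicator
            (fun l => ENNReal.ofReal (l ^ (θ - 1))) l * ENNReal.ofReal (f s) := by
          refine setLIntegral_mono' measurableSet_Ioi fun l hl => ?_
          have hl : 0 < l := hl
          by_cases h : c * l ^ (q / p) < f s
          · have hlb : l ∈ Set.Ioc 0 b := by
              refine ⟨hl, ?_⟩
              have h1 : l ^ (q / p) ≤ f s / c := by
                rw [le_div_iff₀ hc0]; linarith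
              calc l = (l ^ (q / p)) ^ (p / q) := by
                    rw [← Real.rpow_mul hl.le, show q / p * (p / q) = 1 by field_simp,
                      Real.rpow_one]
                _ ≤ b := Real.rpow_le_rpow (by positivity) h1 (by positivity)
            simp [hlb, h]
          · simp [h]
      _ = ENNReal.ofReal (b ^ θ / θ) * ENNReal.ofReal (f s) := by
          rw [lintegral_mul_const _ (Measurable.indicator (by fun_prop) measurableSet_Ioc),
            lintegral_indicator measurableSet_Ioc, Measure.restrict_restrict measurableSet_Ioc,
            Set.inter_eq_left.mpr Set.Ioc_subset_Ioi_self, lintegral_rpow_Ioc hθ0 (by positivity)]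
      _ = _ := by
          rw [← ENNReal.ofReal_mul (by positivity), ← ENNReal.ofReal_mul (by positivity)]
          congr 1
          rw [hb, ← Real.rpow_mul (by positivity), show p / q * θ = p - 1 by
            rw [hθ]; field_simp, Real.div_rpow hfs.le hc0.le, Real.rpow_sub_one hfs.ne',
            show (1 - p) = -(p - 1) by ring, Real.rpow_neg hc0.le]
          field_simp
  calc _ ≤ ENNReal.ofReal q * ∫⁻ l in Set.Ioi (0 : ℝ), ENNReal.ofReal (4 * K / β) *
        ∫⁻ s, ENNReal.ofReal (l ^ (θ - 1)) *
        {s | c * l ^ (q / p) < f s}.indicator (fun s => ENNReal.ofReal (f s)) s := by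
        gcongr ENNReal.ofReal q * ?_
        exact setLIntegral_mono' measurableSet_Ioi hlevel
    _ = ENNReal.ofReal q * (ENNReal.ofReal (4 * K / β) * ∫⁻ s, ∫⁻ l in Set.Ioi (0 : ℝ),
        ENNReal.ofReal (l ^ (θ - 1)) *
        {s | c * l ^ (q / p) < f s}.indicator (fun s => ENNReal.ofReal (f s)) s) := by
        have hm := hjoint.lintegral_prod_right' (ν := (volume : Measure ℝ))
        simp only [Function.uncurry] at hm
        rw [lintegral_const_mul _ hm,
          lintegral_lintegral_swap hjoint.aemeasurable]
    _ ≤ ENNReal.ofReal q * (ENNReal.ofReal (4 * K / β) * ∫⁻ s,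
        ENNReal.ofReal (c ^ (1 - p) / θ) * ENNReal.ofReal (f s ^ p)) := by
        gcongr with s
        exact hinner s
    _ ≤ ENNReal.ofReal q * (ENNReal.ofReal (4 * K / β) * (ENNReal.ofReal (c ^ (1 - p) / θ) * 1)) := by
        rw [lintegral_const_mul _ (by fun_prop)]
        gcongr
    _ = _ := by
        rw [mul_one, ← mul_assoc, ← ENNReal.ofReal_mul hq.le, ← ENNReal.ofReal_mul (by positivity)]

/-- The Hardy–Littlewood–Sobolev inequality on the line, for a function dominated by the Riesz
potential of a nonnegative function. -/
theorem hls {p q β : ℝ} (hp : 1 < p) (hq : 0 < q) (hβ : 0 < β) (hpq : 1 / p - 1 / q = β) :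
    ∃ C : ℝ, 0 < C ∧ ∀ f : ℝ → ℝ, (∀ s, 0 ≤ f s) → Measurable f →
      ∀ F : ℝ → ℝ, (∀ t, 0 ≤ F t) → Measurable F →
      (∀ t, ENNReal.ofReal (F t) ≤
        ∫⁻ s, ENNReal.ofReal (|t - s| ^ (β - 1)) * ENNReal.ofReal (f s)) →
      (∫⁻ t, ENNReal.ofReal (F t ^ q)) ^ (1 / q) ≤
        ENNReal.ofReal C * (∫⁻ s, ENNReal.ofReal (f s ^ p)) ^ (1 / p) := by
  obtain ⟨C, hC, H⟩ := hls_normalized hp hq hβ hpq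
  have hp0 : 0 < p := by linarith
  refine ⟨C ^ (1 / q), by positivity, ?_⟩
  intro f hf0 hfm F hF0 hFm hFle
  have hCne : ENNReal.ofReal (C ^ (1 / q)) ≠ 0 := by
    simpa using Real.rpow_pos_of_pos hC _
  rcases eq_or_ne (∫⁻ s, ENNReal.ofReal (f s ^ p)) ⊤ with htop | htop
  · rw [htop, ENNReal.top_rpow_of_pos (by positivity), ENNReal.mul_top hCne]
    exact le_top
  rcases eq_or_ne (∫⁻ s, ENNReal.ofReal (f s ^ p)) 0 with hz | hz
  · have h1 : ∀ᵐ s, f s = 0 := by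
      rw [lintegral_eq_zero_iff (by fun_prop)] at hz
      filter_upwards [hz] with s hs
      by_contra hne
      have : 0 < f s := lt_of_le_of_ne (hf0 s) (Ne.symm hne)
      have := Real.rpow_pos_of_pos this p
      simp at hs
      linarith
    have h2 : ∀ t, F t = 0 := by
      intro t
      have : ∫⁻ s, ENNReal.ofReal (|t - s| ^ (β - 1)) * ENNReal.ofReal (f s) = 0 := by
        rw [← lintegral_zero (μ := (volume : Measure ℝ))]
        refine lintegral_congr_ae ?_
        filter_upwards [h1] with s hs
        simp [hs]
      have h3 := hFle t
      rw [this] at h3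
      simp at h3
      exact le_antisymm h3 (hF0 t)
    simp [h2, Real.zero_rpow hq.ne', hq]
  set N := (∫⁻ s, ENNReal.ofReal (f s ^ p)).toReal with hN
  have hN0 : 0 < N := ENNReal.toReal_pos hz htop
  have hNe : ∫⁻ s, ENNReal.ofReal (f s ^ p) = ENNReal.ofReal N := (ENNReal.ofReal_toReal htop).symm
  -- Both sides are homogeneous, so scaling by `a` reduces to unit p-norm.
  set a := (N ^ (1 / p))⁻¹ with ha
  have ha0 : 0 < a := by positivity
  have hap : a ^ p = N⁻¹ := by
    rw [ha, Real.inv_rpow (by positivity), ← Real.rpow_mul hN0.le, one_div_mul_cancel hp0.ne',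
      Real.rpow_one]
  have key := H (fun s => a * f s) (fun s => mul_nonneg ha0.le (hf0 s)) (by fun_prop) (by
      have : ∀ s, ENNReal.ofReal ((a * f s) ^ p) =
          ENNReal.ofReal (N⁻¹) * ENNReal.ofReal (f s ^ p) := by
        intro s
        rw [Real.mul_rpow ha0.le (hf0 s), hap, ENNReal.ofReal_mul (by positivity)]
      simp_rw [this]
      rw [lintegral_const_mul _ (by fun_prop), hNe, ← ENNReal.ofReal_mul (by positivity),
        inv_mul_cancel₀ hN0.ne']
      simp)
    (fun t => a * F t) (fun t => mul_nonneg ha0.le (hF0 t)) (by fun_prop) (by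
      intro t
      rw [ENNReal.ofReal_mul ha0.le]
      refine (mul_le_mul_right (hFle t) _).trans (le_of_eq ?_)
      rw [← lintegral_const_mul _ (by fun_prop)]
      refine lintegral_congr fun s => ?_
      rw [ENNReal.ofReal_mul ha0.le]
      ring)
  have h3 : ∫⁻ t, ENNReal.ofReal (F t ^ q) =
      ENNReal.ofReal ((a ^ q)⁻¹) * ∫⁻ t, ENNReal.ofReal ((a * F t) ^ q) := by
    rw [← lintegral_const_mul _ (by fun_prop)]
    refine lintegral_congr fun t => ?_
    rw [← ENNReal.ofReal_mul (by positivity), Real.mul_rpow ha0.le (hF0 t),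
      inv_mul_cancel_left₀ (by positivity)]
  calc _ ≤ (ENNReal.ofReal ((a ^ q)⁻¹) * ENNReal.ofReal C) ^ (1 / q) := by
        rw [h3]
        gcongr
    _ = _ := by
        rw [hNe, ← ENNReal.ofReal_mul (by positivity), ENNReal.ofReal_rpow_of_pos (by positivity),
          ENNReal.ofReal_rpow_of_pos hN0, ← ENNReal.ofReal_mul (by positivity)]
        congr 1
        rw [Real.mul_rpow (by positivity) hC.le, Real.inv_rpow (by positivity),
          ← Real.rpow_mul ha0.le, mul_one_div_cancel hq.ne', Real.rpow_one, ha, inv_inv, mul_comm]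

/-! ### Exponential sums dominated by the Riesz kernel. -/

/-- Bernoulli's inequality for the concave power 1 - β shows that each term is at most the
corresponding increment of the right-hand side. -/
theorem sum_range_rpow_neg_le {β : ℝ} (hβ0 : 0 < β) (hβ1 : β < 1) (N : ℕ) :
    ∑ n ∈ Finset.range N, ((n : ℝ) + 1) ^ (-β) ≤ (N : ℝ) ^ (1 - β) / (1 - β) := by
  have h1β : 0 < 1 - β := by linarith
  induction N with
  | zero => simp [Real.zero_rpow h1β.ne']
  | succ N ih =>
    rw [Finset.sum_range_succ]
    have hN : (0 : ℝ) < (N : ℝ) + 1 := by positivity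
    have hb := rpow_one_add_le_one_add_mul_self (s := -1 / ((N : ℝ) + 1)) (p := 1 - β)
      (by rw [le_div_iff₀ hN]; nlinarith [Nat.cast_nonneg (α := ℝ) N]) h1β.le (by linarith)
    have h2 : (N : ℝ) = ((N : ℝ) + 1) * (1 + -1 / ((N : ℝ) + 1)) := by field_simp; ring
    have h3 : (0 : ℝ) ≤ 1 + -1 / ((N : ℝ) + 1) := by
      have : 1 + -1 / ((N : ℝ) + 1) = N / (N + 1) := by field_simp; ring
      rw [this]; positivity
    have h4 : (N : ℝ) ^ (1 - β) ≤ ((N : ℝ) + 1) ^ (1 - β) * (1 + (1 - β) * (-1 / ((N : ℝ) + 1))) := by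
      conv_lhs => rw [h2, Real.mul_rpow hN.le h3]
      gcongr
    have h5 : ((N : ℝ) + 1) ^ (1 - β) = ((N : ℝ) + 1) * ((N : ℝ) + 1) ^ (-β) := by
      rw [sub_eq_add_neg, Real.rpow_add hN, Real.rpow_one]
    push_cast
    rw [h5] at h4 ⊢
    calc _ ≤ ((N : ℝ) + 1) * ((N : ℝ) + 1) ^ (-β) * (1 + (1 - β) * (-1 / ((N : ℝ) + 1))) / (1 - β)
          + ((N : ℝ) + 1) ^ (-β) := by
          gcongr
          exact ih.trans (by gcongr)
      _ = _ := by
          field_simp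
          ring

/-- Injectivity allows comparison with the full geometric series r/(1-r), r = e^(-y), and r/(1-r) ≤
1/y is equivalent to 1 + y ≤ e^y. -/
theorem sum_exp_neg_succ_le {ι : Type*} {y : ℝ} (hy : 0 < y) (s : Finset ι) (φ : ι → ℕ)
    (hφ : Set.InjOn φ s) : ∑ i ∈ s, Real.exp (-(((φ i : ℝ) + 1) * y)) ≤ 1 / y := by
  classical
  set r := Real.exp (-y) with hr
  have hr0 : 0 < r := Real.exp_pos _
  have hr1 : r < 1 := by rw [hr, Real.exp_lt_one_iff]; linarith
  have hs : Summable fun k : ℕ => r * r ^ k := (summable_geometric_of_lt_one hr0.le hr1).mul_left r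
  have h1 : ∀ i, Real.exp (-(((φ i : ℝ) + 1) * y)) = r * r ^ φ i := by
    intro i
    rw [hr, ← Real.exp_nat_mul, ← Real.exp_add]
    ring_nf
  simp_rw [h1]
  rw [← Finset.sum_image (f := fun k : ℕ => r * r ^ k) hφ]
  refine (hs.sum_le_tsum _ fun k _ => by positivity).trans ?_
  rw [tsum_mul_left, tsum_geometric_of_lt_one hr0.le hr1]
  have h2 : r * (y + 1) ≤ 1 := by
    have := Real.add_one_le_exp y
    calc r * (y + 1) ≤ r * Real.exp y := by gcongr
      _ = 1 := by rw [hr, ← Real.exp_add]; simp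
  rw [← div_eq_mul_inv, div_le_div_iff₀ (by linarith) hy]
  linarith

/-- With m the integer nearest to σ, |σ - n| ≥ min(c, 1/4)(|n - m| + 1): the gap c handles n = m,
and k - 1/2 ≥ (k + 1)/4 for k ≥ 1 handles the rest. On either side of m the map n ↦ |n - m| is
injective, hence two geometric sums and the factor 2. -/
theorem sum_exp_neg_abs_le {c σ x : ℝ} (hc : 0 < c) (hσ : ∀ n : ℤ, c ≤ |σ - n|) (hx : 0 < x)
    (s : Finset ℕ) :
    ∑ n ∈ s, Real.exp (-(|σ - n| * x)) ≤ 2 / (min c (1 / 4) * x) := by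
  classical
  set c' := min c (1 / 4) with hc'
  have hc0 : 0 < c' := by positivity
  set m := round σ with hm
  have hdist : ∀ n : ℕ, (((n - m).natAbs : ℕ) + 1) * c' ≤ |σ - n| := by
    intro n
    rcases Nat.eq_zero_or_pos ((n : ℤ) - m).natAbs with h0 | h0
    · rw [h0]
      have := (min_le_left c (1 / 4)).trans (hσ n)
      rw [Nat.cast_zero, zero_add, one_mul]
      exact_mod_cast this
    · have h1 : (((n : ℤ) - m).natAbs : ℝ) = |(n : ℝ) - m| := by
        rw [Nat.cast_natAbs]; push_cast; rfl
      have h2 : |σ - m| ≤ 1 / 2 := abs_sub_round σ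
      have h3 : |(n : ℝ) - m| ≤ |σ - n| + |σ - m| := by
        rw [abs_sub_comm σ n]
        exact abs_sub_le _ _ _
      have h4 : (1 : ℝ) ≤ (((n : ℤ) - m).natAbs : ℝ) := by exact_mod_cast h0
      rw [h1] at h4 ⊢
      calc (|(n : ℝ) - m| + 1) * c' ≤ (|(n : ℝ) - m| + 1) * (1 / 4) := by
            gcongr
            exact min_le_right _ _
        _ ≤ _ := by linarith
  have hle : ∀ n ∈ s, Real.exp (-(|σ - n| * x)) ≤
      Real.exp (-(((((n - m).natAbs : ℕ) : ℝ) + 1) * (c' * x))) := by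
    intro n _
    rw [Real.exp_le_exp, neg_le_neg_iff, ← mul_assoc]
    gcongr
    exact hdist n
  refine (Finset.sum_le_sum hle).trans ?_
  rw [← Finset.sum_filter_add_sum_filter_not s (fun n : ℕ => m ≤ n),
    show 2 / (c' * x) = 1 / (c' * x) + 1 / (c' * x) by ring]
  gcongr
  · refine sum_exp_neg_succ_le (by positivity) _ (fun n : ℕ => ((n : ℤ) - m).natAbs) ?_
    intro a ha b hb hab
    simp only [Finset.coe_filter, Set.mem_ofPred_eq] at ha hb hab
    omega
  · refine sum_exp_neg_succ_le (by positivity) _ (fun n : ℕ => ((n : ℤ) - m).natAbs) ?_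
    intro a ha b hb hab
    simp only [Finset.coe_filter, Set.mem_ofPred_eq] at ha hb hab
    omega

/-- Split at n + 1 = 1/x. Below, the exponential is dropped and the power sum is O(x^(β-1)); above,
the power is at most x^β and the exponentials sum to O(1/x). Neither bound sees where σ lies, only
its gap from the integers. -/
theorem sum_rpow_mul_exp_le {β c σ x : ℝ} (hβ0 : 0 < β) (hβ1 : β < 1) (hc : 0 < c)
    (hσ : ∀ n : ℤ, c ≤ |σ - n|) (hx : 0 < x) (N : ℕ) :
    ∑ n ∈ Finset.range N, ((n : ℝ) + 1) ^ (-β) * Real.exp (-(|σ - n| * x)) ≤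
      (1 / (1 - β) + 2 / min c (1 / 4)) * x ^ (β - 1) := by
  classical
  have h1β : 0 < 1 - β := by linarith
  rw [← Finset.sum_filter_add_sum_filter_not _ (fun n : ℕ => (n : ℝ) + 1 ≤ 1 / x), add_mul]
  gcongr
  · calc _ ≤ ∑ n ∈ (Finset.range N).filter (fun n : ℕ => (n : ℝ) + 1 ≤ 1 / x), ((n : ℝ) + 1) ^ (-β) := by
          refine Finset.sum_le_sum fun n _ => mul_le_of_le_one_right (by positivity) ?_
          rw [Real.exp_le_one_iff, neg_nonpos]
          positivity
      _ ≤ ∑ n ∈ Finset.range ⌊1 / x⌋₊, ((n : ℝ) + 1) ^ (-β) := by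
          refine Finset.sum_le_sum_of_subset_of_nonneg ?_ fun n _ _ => by positivity
          intro n hn
          simp only [Finset.mem_filter, Finset.mem_range] at hn ⊢
          rw [← Nat.succ_le_iff]
          refine Nat.le_floor ?_
          push_cast
          exact hn.2
      _ ≤ (⌊1 / x⌋₊ : ℝ) ^ (1 - β) / (1 - β) := sum_range_rpow_neg_le hβ0 hβ1 _
      _ ≤ (1 / x) ^ (1 - β) / (1 - β) := by
          gcongr
          exact Nat.floor_le (by positivity)
      _ = _ := by
          rw [one_div, Real.inv_rpow hx.le, ← Real.rpow_neg hx.le]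
          ring_nf
  · calc _ ≤ ∑ n ∈ (Finset.range N).filter (fun n : ℕ => ¬ (n : ℝ) + 1 ≤ 1 / x),
            x ^ β * Real.exp (-(|σ - n| * x)) := by
          refine Finset.sum_le_sum fun n hn => ?_
          simp only [Finset.mem_filter, not_le] at hn
          gcongr
          calc ((n : ℝ) + 1) ^ (-β) ≤ (1 / x) ^ (-β) :=
                Real.rpow_le_rpow_of_nonpos (by positivity) hn.2.le (by linarith)
            _ = x ^ β := by rw [one_div, Real.inv_rpow hx.le, Real.rpow_neg hx.le, inv_inv]
      _ ≤ x ^ β * (2 / (min c (1 / 4) * x)) := by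
          rw [← Finset.mul_sum]
          gcongr
          exact sum_exp_neg_abs_le hc hσ hx _
      _ = _ := by
          rw [Real.rpow_sub_one hx.ne']
          field_simp

/-! ### Decaying Green kernels for constant-coefficient operators on the line. -/

/-- The fundamental solution of `d/dt + a` that decays at both ends (for `a ≠ 0`). -/
def expKernel (a t : ℝ) : ℝ :=
  if 0 < a then (if 0 < t then Real.exp (-(a * t)) else 0)
  else (if t < 0 then -Real.exp (-(a * t)) else 0)

theorem abs_expKernel_le (a t : ℝ) : |expKernel a t| ≤ Real.exp (-(|a| * |t|)) := by
  unfold expKernel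
  split_ifs with h1 h2 h2
  · rw [abs_of_pos h1, abs_of_pos h2, abs_of_pos (Real.exp_pos _)]
  · simpa using (Real.exp_pos _).le
  · rw [abs_of_nonpos (not_lt.mp h1), abs_of_neg h2, abs_neg, abs_of_pos (Real.exp_pos _)]
    simp
  · simpa using (Real.exp_pos _).le

theorem measurable_expKernel (a : ℝ) : Measurable (expKernel a) := by
  unfold expKernel
  split_ifs
  · exact Measurable.ite measurableSet_Ioi (by fun_prop) measurable_const
  · exact Measurable.ite measurableSet_Iio (by fun_prop) measurable_const

theorem integrable_expKernel_smul {X : Type*} [NormedAddCommGroup X] [NormedSpace ℝ X]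
    {g : ℝ → X} (hg : Continuous g) (hgc : HasCompactSupport g) (a t : ℝ) :
    Integrable fun s => expKernel a (t - s) • g s := by
  have hgi : Integrable g := hg.integrable_of_hasCompactSupport hgc
  have hm : Measurable fun s => expKernel a (t - s) := (measurable_expKernel a).comp (by fun_prop)
  refine hgi.bdd_smul (C := 1) hm.aestronglyMeasurable ?_
  refine Filter.Eventually.of_forall fun s => ?_
  rw [Real.norm_eq_abs]
  refine (abs_expKernel_le _ _).trans ?_
  rw [Real.exp_le_one_iff, neg_nonpos]
  positivity

theorem HasCompactSupport.fun_smul_left {X Y : Type*} [TopologicalSpace X] [NormedAddCommGroup Y]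
    [NormedSpace ℝ Y] {g : X → Y} (hg : HasCompactSupport g) (f : X → ℝ) :
    HasCompactSupport fun s => f s • g s :=
  hg.mono fun s hs h => hs (by simp [h])

/-- The integrand is the s-derivative of e^(-a(t-s)) ψ(s), up to sign when a < 0. Integrating over
the half-line where the kernel lives leaves only the value at s = t, by compact support. -/
theorem eq_integral_expKernel {a : ℝ} (ha : a ≠ 0) {ψ ψ' : ℝ → ℂ}
    (hψ : ∀ t, HasDerivAt ψ (ψ' t) t) (hψ' : Continuous ψ') (hc : HasCompactSupport ψ) (t : ℝ) :
    ψ t = ∫ s, expKernel a (t - s) • (ψ' s + (a : ℂ) * ψ s) := by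
  have hcont : Continuous ψ := continuous_iff_continuousAt.mpr fun t => (hψ t).continuousAt
  have hc' : HasCompactSupport ψ' := by
    have : ψ' = deriv ψ := funext fun t => (hψ t).deriv.symm
    rw [this]; exact hc.deriv
  have hd : ∀ s, HasDerivAt (fun s => Real.exp (-(a * (t - s))) • ψ s)
      (Real.exp (-(a * (t - s))) • (ψ' s + (a : ℂ) * ψ s)) s := by
    intro s
    have h1 : HasDerivAt (fun s => Real.exp (-(a * (t - s)))) (Real.exp (-(a * (t - s))) * a) s := by
      have h2 : HasDerivAt (fun s => -(a * (t - s))) a s := by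
        convert! (((hasDerivAt_id s).const_sub t).const_mul a).neg using 1
        simp
      exact h2.exp
    convert! h1.smul (hψ s) using 1
    simp only [Complex.real_smul]
    push_cast
    ring
  have hccs : HasCompactSupport fun s => Real.exp (-(a * (t - s))) • ψ s := hc.fun_smul_left _
  have hint : Integrable fun s => Real.exp (-(a * (t - s))) • (ψ' s + (a : ℂ) * ψ s) := by
    refine Continuous.integrable_of_hasCompactSupport (by fun_prop) ?_
    exact HasCompactSupport.fun_smul_left (hc'.add hc.mul_left) _
  rcases lt_or_gt_of_ne ha with hneg | hpos
  · have h := integral_Ioi_of_hasDerivAt_of_tendsto' (a := t) (fun s _ => hd s) hint.integrableOn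
      (hccs.is_zero_at_infty.mono_left atTop_le_cocompact)
    have : ∀ s, expKernel a (t - s) • (ψ' s + (a : ℂ) * ψ s) =
        -(Set.Ioi t).indicator (fun s => Real.exp (-(a * (t - s))) • (ψ' s + (a : ℂ) * ψ s)) s := by
      intro s
      by_cases hs : t < s
      · rw [Set.indicator_of_mem (Set.mem_Ioi.mpr hs)]; simp [expKernel, hneg.not_gt, hs]; ring
      · rw [Set.indicator_of_notMem (show s ∉ Set.Ioi t from hs)]; simp [expKernel, hneg.not_gt, hs]
    simp_rw [this]
    rw [integral_neg, integral_indicator measurableSet_Ioi, h]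
    simp
  · have h := integral_Iic_of_hasDerivAt_of_tendsto' (a := t) (fun s _ => hd s) hint.integrableOn
      (hccs.is_zero_at_infty.mono_left atBot_le_cocompact)
    have : ∀ s, expKernel a (t - s) • (ψ' s + (a : ℂ) * ψ s) =
        (Set.Iio t).indicator (fun s => Real.exp (-(a * (t - s))) • (ψ' s + (a : ℂ) * ψ s)) s := by
      intro s
      by_cases hs : s < t
      · rw [Set.indicator_of_mem (Set.mem_Iio.mpr hs)]; simp [expKernel, hpos, hs]
      · rw [Set.indicator_of_notMem (show s ∉ Set.Iio t from hs)]; simp [expKernel, hpos, hs]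
    simp_rw [this]
    rw [integral_indicator measurableSet_Iio, setIntegral_congr_set Iio_ae_eq_Iic, h]
    simp

/-- The Green kernel of `(d/dt + a)(d/dt + b)`. -/
def greenKernel (a b t : ℝ) : ℝ := (expKernel a t - expKernel b t) / (b - a)

theorem abs_greenKernel_le {a b : ℝ} (hab : a < b) (t : ℝ) :
    |greenKernel a b t| ≤ (Real.exp (-(|a| * |t|)) + Real.exp (-(|b| * |t|))) / (b - a) := by
  rw [greenKernel, abs_div, abs_of_pos (sub_pos.mpr hab)]
  have h0 : 0 < b - a := sub_pos.mpr hab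
  gcongr
  exact (abs_sub _ _).trans (add_le_add (abs_expKernel_le _ _) (abs_expKernel_le _ _))

theorem measurable_greenKernel (a b : ℝ) : Measurable (greenKernel a b) :=
  ((measurable_expKernel a).sub (measurable_expKernel b)).div_const _

theorem greenKernel_smul {X : Type*} [AddCommGroup X] [Module ℝ X] (a b t : ℝ) (x : X) :
    greenKernel a b t • x =
      (b - a)⁻¹ • (expKernel a t • x - expKernel b t • x) := by
  rw [greenKernel, ← sub_smul, smul_smul, div_eq_inv_mul]

theorem integrable_greenKernel_smul {X : Type*} [NormedAddCommGroup X] [NormedSpace ℝ X]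
    {g : ℝ → X} (hg : Continuous g) (hgc : HasCompactSupport g) (a b t : ℝ) :
    Integrable fun s => greenKernel a b (t - s) • g s := by
  simp_rw [greenKernel_smul]
  exact ((integrable_expKernel_smul hg hgc a t).sub (integrable_expKernel_smul hg hgc b t)).smul _

/-- Partial fractions: the first-order formula recovers φ' + bφ with kernel a and φ' + aφ with
kernel b, and the two differ by (b - a)φ. -/
theorem eq_integral_greenKernel {a b : ℝ} (ha : a ≠ 0) (hb : b ≠ 0) (hab : a ≠ b)
    {φ φ' φ'' : ℝ → ℂ} (h1 : ∀ t, HasDerivAt φ (φ' t) t) (h2 : ∀ t, HasDerivAt φ' (φ'' t) t)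
    (h3 : Continuous φ'') (hc : HasCompactSupport φ) (t : ℝ) :
    φ t = ∫ s, greenKernel a b (t - s) • (φ'' s + ((a : ℂ) + b) * φ' s + (a : ℂ) * b * φ s) := by
  have hφ : Continuous φ := continuous_iff_continuousAt.mpr fun t => (h1 t).continuousAt
  have hφ' : Continuous φ' := continuous_iff_continuousAt.mpr fun t => (h2 t).continuousAt
  have hc' : HasCompactSupport φ' := by
    have : φ' = deriv φ := funext fun t => (h1 t).deriv.symm
    rw [this]; exact hc.deriv
  have hc'' : HasCompactSupport φ'' := by
    have : φ'' = deriv φ' := funext fun t => (h2 t).deriv.symm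
    rw [this]; exact hc'.deriv
  have key : ∀ a b : ℝ, a ≠ 0 → φ' t + (b : ℂ) * φ t =
      ∫ s, expKernel a (t - s) • (φ'' s + ((a : ℂ) + b) * φ' s + (a : ℂ) * b * φ s) := by
    intro a b ha
    rw [eq_integral_expKernel (ψ := fun t => φ' t + (b : ℂ) * φ t)
      (ψ' := fun t => φ'' t + (b : ℂ) * φ' t) ha (fun t => (h2 t).add ((h1 t).const_mul _))
      (by fun_prop) (hc'.add hc.mul_left) t]
    congr 1
    ext s
    congr 1
    ring
  have hgc : Continuous fun s => φ'' s + ((a : ℂ) + b) * φ' s + (a : ℂ) * b * φ s := by fun_prop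
  have hgs : HasCompactSupport fun s => φ'' s + ((a : ℂ) + b) * φ' s + (a : ℂ) * b * φ s :=
    (hc''.add hc'.mul_left).add hc.mul_left
  simp_rw [greenKernel_smul]
  rw [integral_smul, integral_sub (integrable_expKernel_smul hgc hgs a t)
    (integrable_expKernel_smul hgc hgs b t), ← key a b ha]
  have := key b a hb
  simp_rw [add_comm (b : ℂ) (a : ℂ), mul_comm (b : ℂ) (a : ℂ)] at this
  rw [← this, Complex.real_smul]
  push_cast
  have : (b : ℂ) - a ≠ 0 := by
    rw [← Complex.ofReal_sub, Complex.ofReal_ne_zero]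
    exact sub_ne_zero.mpr hab.symm
  field_simp
  ring

/-! ### Rotations and Green's identity on the sphere. -/

/-- Differentiation under the integral sign over a compact space. -/
theorem hasDerivAt_integral_of_compactSpace {S : Type*} [TopologicalSpace S] [CompactSpace S]
    [MeasurableSpace S] [OpensMeasurableSpace S] [SecondCountableTopology S]
    (μ : Measure S) [IsFiniteMeasure μ]
    {F F' : ℝ → S → ℂ} (hF : ∀ t, Continuous (F t)) (hF' : Continuous (Function.uncurry F'))
    (hd : ∀ t ω, HasDerivAt (fun t => F t ω) (F' t ω) t) (t : ℝ) :
    HasDerivAt (fun t => ∫ ω, F t ω ∂μ) (∫ ω, F' t ω ∂μ) t := by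
  obtain ⟨C, hC⟩ := ((isCompact_Icc (a := t - 1) (b := t + 1)).prod
    (isCompact_univ (X := S))).exists_bound_of_continuousOn hF'.continuousOn
  have hint : Integrable (F t) μ := by
    obtain ⟨C', hC'⟩ := (isCompact_univ (X := S)).exists_bound_of_continuousOn (hF t).continuousOn
    exact Integrable.of_bound (hF t).aestronglyMeasurable C'
      (Filter.Eventually.of_forall fun ω => hC' ω (Set.mem_univ _))
  have hF't : Continuous (F' t) := hF'.comp (by fun_prop : Continuous fun ω => (t, ω))
  exact (hasDerivAt_integral_of_dominated_loc_of_deriv_le (bound := fun _ => C)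
    (Icc_mem_nhds (by linarith : t - 1 < t) (by linarith : t < t + 1))
    (Filter.Eventually.of_forall fun t => (hF t).aestronglyMeasurable) hint
    hF't.aestronglyMeasurable
    (Filter.Eventually.of_forall fun ω x hx => hC (x, ω) ⟨hx, Set.mem_univ _⟩)
    (integrable_const _) (Filter.Eventually.of_forall fun ω x _ => hd x ω)).2

/-- The action of a linear isometry on the unit sphere. -/
def sphereMap {d : ℕ} (e : (EuclideanSpace ℝ (Fin d)) ≃ₗᵢ[ℝ] (EuclideanSpace ℝ (Fin d))) (ω : USphere d) : USphere d :=
  ⟨e ω, by simp⟩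

theorem continuous_sphereMap {d : ℕ} (e : (EuclideanSpace ℝ (Fin d)) ≃ₗᵢ[ℝ] (EuclideanSpace ℝ (Fin d))) : Continuous (sphereMap e) :=
  Continuous.subtype_mk (e.continuous.comp continuous_subtype_val) _

-- Surface measure is a multiple of the volume of the cone over a set; an isometry carries cones to
-- cones and preserves volume.
open scoped Pointwise in
theorem measurePreserving_sphereMap {d : ℕ} (e : (EuclideanSpace ℝ (Fin d)) ≃ₗᵢ[ℝ] (EuclideanSpace ℝ (Fin d))) :
    MeasurePreserving (sphereMap e) (surfaceMeasure d) (surfaceMeasure d) := by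
  have hm := (continuous_sphereMap e).measurable
  refine ⟨hm, ?_⟩
  ext s hs
  rw [Measure.map_apply hm hs, Measure.toSphere_apply' _ (hm hs), Measure.toSphere_apply' _ hs]
  congr 1
  have hset : Set.Ioo (0 : ℝ) 1 • ((↑) '' (sphereMap e ⁻¹' s) : Set (EuclideanSpace ℝ (Fin d))) =
      e ⁻¹' (Set.Ioo (0 : ℝ) 1 • ((↑) '' s : Set (EuclideanSpace ℝ (Fin d)))) := by
    ext x
    simp only [Set.mem_smul, Set.mem_image, Set.mem_preimage]
    constructor
    · rintro ⟨r, hr, _, ⟨ω, hω, rfl⟩, rfl⟩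
      exact ⟨r, hr, _, ⟨_, hω, rfl⟩, by simp [sphereMap]⟩
    · rintro ⟨r, hr, _, ⟨ω, hω, rfl⟩, hx⟩
      refine ⟨r, hr, e.symm ω, ⟨⟨e.symm ω, by simp⟩, ?_, rfl⟩, ?_⟩
      · simpa [sphereMap] using hω
      · rw [← map_smul, hx, e.symm_apply_apply]
  rw [hset]
  exact e.measurePreserving.measure_preimage_equiv (f := e.toMeasurableEquiv) _

theorem integral_sphere_comp {d : ℕ} (e : (EuclideanSpace ℝ (Fin d)) ≃ₗᵢ[ℝ] (EuclideanSpace ℝ (Fin d))) {u : (EuclideanSpace ℝ (Fin d)) → ℂ}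
    (hu : Continuous u) :
    ∫ ω : USphere d, u (e ω) ∂(surfaceMeasure d) = ∫ ω : USphere d, u ω ∂(surfaceMeasure d) := by
  have h := (measurePreserving_sphereMap e).map_eq
  conv_rhs => rw [← h]
  rw [integral_map (continuous_sphereMap e).measurable.aemeasurable
    (by fun_prop)]
  rfl

/-- The derivative of `u` along the linear vector field `x ↦ A x`. -/
def fieldDeriv {d : ℕ} (A : (EuclideanSpace ℝ (Fin d)) →L[ℝ] (EuclideanSpace ℝ (Fin d))) (u : (EuclideanSpace ℝ (Fin d)) → ℂ) (x : EuclideanSpace ℝ (Fin d)) : ℂ :=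
  fderiv ℝ u x (A x)

theorem ContDiff.fieldDeriv {d : ℕ} {u : (EuclideanSpace ℝ (Fin d)) → ℂ} (hu : ContDiff ℝ (⊤ : ℕ∞) u)
    (A : (EuclideanSpace ℝ (Fin d)) →L[ℝ] (EuclideanSpace ℝ (Fin d))) : ContDiff ℝ (⊤ : ℕ∞) (fieldDeriv A u) :=
  (hu.fderiv_right (m := (⊤ : ℕ∞)) (by simp)).clm_apply A.contDiff

/-- The flow exp(θA) is orthogonal, so the integral of u over the sphere does not change along it;
the claim is its derivative at θ = 0. -/
theorem integral_fieldDeriv_of_skew {d : ℕ} {A : (EuclideanSpace ℝ (Fin d)) →L[ℝ] (EuclideanSpace ℝ (Fin d))}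
    (hA : A ∈ skewAdjoint ((EuclideanSpace ℝ (Fin d)) →L[ℝ] (EuclideanSpace ℝ (Fin d)))) {u : (EuclideanSpace ℝ (Fin d)) → ℂ} (hu : ContDiff ℝ 1 u) :
    ∫ ω : USphere d, fieldDeriv A u ω ∂(surfaceMeasure d) = 0 := by
  set R : ℝ → (EuclideanSpace ℝ (Fin d)) →L[ℝ] (EuclideanSpace ℝ (Fin d)) := fun θ => NormedSpace.exp (θ • A) with hR
  let _ : NormedAlgebra ℚ ((EuclideanSpace ℝ (Fin d)) →L[ℝ] (EuclideanSpace ℝ (Fin d))) :=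
    NormedAlgebra.restrictScalars ℚ ℝ _
  have hR0 : R 0 = 1 :=
    (congrArg NormedSpace.exp (zero_smul ℝ A)).trans NormedSpace.exp_zero
  have hunit : ∀ θ, R θ ∈ unitary ((EuclideanSpace ℝ (Fin d)) →L[ℝ] (EuclideanSpace ℝ (Fin d))) := fun θ =>
    NormedSpace.exp_mem_unitary_of_mem_skewAdjoint (skewAdjoint.smul_mem θ hA)
  have hRd : ∀ θ, HasDerivAt R (A * R θ) θ := fun θ => hasDerivAt_exp_smul_const' A θ
  have hRc : Continuous R := continuous_iff_continuousAt.mpr fun θ => (hRd θ).continuousAt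
  have hu' : Continuous (fderiv ℝ u) := hu.continuous_fderiv (by simp)
  have hcd : HasDerivAt (fun θ => ∫ ω : USphere d, u (R θ ω) ∂(surfaceMeasure d))
      (∫ ω : USphere d, fderiv ℝ u (R 0 ω) (A (R 0 ω)) ∂(surfaceMeasure d)) 0 := by
    refine hasDerivAt_integral_of_compactSpace (surfaceMeasure d)
      (F := fun θ ω => u (R θ ω)) (F' := fun θ ω => fderiv ℝ u (R θ ω) (A (R θ ω))) ?_ ?_ ?_ 0
    · intro θ
      exact hu.continuous.comp ((R θ).continuous.comp continuous_subtype_val)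
    · have h1 : Continuous fun x : ℝ × USphere d => R x.1 x.2 :=
        (hRc.comp continuous_fst).clm_apply (continuous_subtype_val.comp continuous_snd)
      exact (hu'.comp h1).clm_apply (A.continuous.comp h1)
    · intro θ ω
      have h1 : HasDerivAt (fun θ => R θ ω) (A (R θ ω)) θ := by
        simpa using (hRd θ).clm_apply (hasDerivAt_const θ (ω : EuclideanSpace ℝ (Fin d)))
      exact ((hu.differentiable (by simp)) _).hasFDerivAt.comp_hasDerivAt θ h1
  have hconst : (fun θ => ∫ ω : USphere d, u (R θ ω) ∂(surfaceMeasure d)) =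
      fun _ => ∫ ω : USphere d, u ω ∂(surfaceMeasure d) := by
    funext θ
    exact integral_sphere_comp (Unitary.linearIsometryEquiv ⟨R θ, hunit θ⟩) hu.continuous
  rw [hconst] at hcd
  have := hcd.unique (hasDerivAt_const _ _)
  rw [hR0] at this
  simpa [fieldDeriv] using this

theorem fieldDeriv_mul {d : ℕ} (A : (EuclideanSpace ℝ (Fin d)) →L[ℝ] (EuclideanSpace ℝ (Fin d))) {u h : (EuclideanSpace ℝ (Fin d)) → ℂ}
    (hu : Differentiable ℝ u) (hh : Differentiable ℝ h) (x : EuclideanSpace ℝ (Fin d)) :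
    fieldDeriv A (fun x => u x * h x) x = fieldDeriv A u x * h x + u x * fieldDeriv A h x := by
  simp only [fieldDeriv]
  rw [fderiv_fun_mul (hu x) (hh x)]
  simp
  ring

theorem Continuous.integrable_sphere {d : ℕ} {f : (EuclideanSpace ℝ (Fin d)) → ℂ} (hf : Continuous f) :
    Integrable (fun ω : USphere d => f ω) (surfaceMeasure d) := by
  have hc : Continuous fun ω : USphere d => f ω := hf.comp continuous_subtype_val
  obtain ⟨C, hC⟩ := (isCompact_univ (X := USphere d)).exists_bound_of_continuousOn hc.continuousOn
  exact Integrable.of_bound hc.aestronglyMeasurable C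
    (Filter.Eventually.of_forall fun ω => hC ω (Set.mem_univ _))

/-- The fields A(Au · h) and A(u · Ah) both integrate to zero; subtracting cancels the common term
Au · Ah. -/
theorem integral_fieldDeriv_twice_mul {d : ℕ} {A : (EuclideanSpace ℝ (Fin d)) →L[ℝ] (EuclideanSpace ℝ (Fin d))}
    (hA : A ∈ skewAdjoint ((EuclideanSpace ℝ (Fin d)) →L[ℝ] (EuclideanSpace ℝ (Fin d)))) {u h : (EuclideanSpace ℝ (Fin d)) → ℂ}
    (hu : ContDiff ℝ (⊤ : ℕ∞) u) (hh : ContDiff ℝ (⊤ : ℕ∞) h) :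
    ∫ ω : USphere d, fieldDeriv A (fieldDeriv A u) ω * h ω ∂(surfaceMeasure d) =
      ∫ ω : USphere d, u ω * fieldDeriv A (fieldDeriv A h) ω ∂(surfaceMeasure d) := by
  have hAu := hu.fieldDeriv A
  have hAh := hh.fieldDeriv A
  have hAAu := hAu.fieldDeriv A
  have hAAh := hAh.fieldDeriv A
  have dif : ∀ {f : (EuclideanSpace ℝ (Fin d)) → ℂ}, ContDiff ℝ (⊤ : ℕ∞) f → Differentiable ℝ f :=
    fun hf => hf.differentiable (by simp)
  have h1 := integral_fieldDeriv_of_skew hA ((hAu.mul hh).of_le (by exact_mod_cast le_top))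
  have h2 := integral_fieldDeriv_of_skew hA ((hu.mul hAh).of_le (by exact_mod_cast le_top))
  simp_rw [fieldDeriv_mul A (dif hAu) (dif hh)] at h1
  simp_rw [fieldDeriv_mul A (dif hu) (dif hAh)] at h2
  have i1 : Integrable (fun ω : USphere d => fieldDeriv A (fieldDeriv A u) ω * h ω)
    (surfaceMeasure d) := (hAAu.continuous.mul hh.continuous).integrable_sphere
  have i2 : Integrable (fun ω : USphere d => fieldDeriv A u ω * fieldDeriv A h ω)
    (surfaceMeasure d) := (hAu.continuous.mul hAh.continuous).integrable_sphere
  have i3 : Integrable (fun ω : USphere d => u ω * fieldDeriv A (fieldDeriv A h) ω)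
    (surfaceMeasure d) := (hu.continuous.mul hAAh.continuous).integrable_sphere
  rw [integral_add i1 i2] at h1
  rw [integral_add i2 i3] at h2
  linear_combination h1 - h2

theorem fieldDeriv_fieldDeriv {d : ℕ} (A : (EuclideanSpace ℝ (Fin d)) →L[ℝ] (EuclideanSpace ℝ (Fin d))) {u : (EuclideanSpace ℝ (Fin d)) → ℂ}
    (hu : ContDiff ℝ (⊤ : ℕ∞) u) (x : EuclideanSpace ℝ (Fin d)) :
    fieldDeriv A (fieldDeriv A u) x =
      fderiv ℝ (fderiv ℝ u) x (A x) (A x) + fderiv ℝ u x (A (A x)) := by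
  have h1 : Differentiable ℝ (fderiv ℝ u) :=
    (hu.fderiv_right (m := (⊤ : ℕ∞)) (by simp)).differentiable (by simp)
  have h2 : HasFDerivAt (fieldDeriv A u) _ x := (h1 x).hasFDerivAt.clm_apply A.hasFDerivAt
  conv_lhs => rw [fieldDeriv]
  rw [h2.fderiv]
  simp [add_comm]

/-- The infinitesimal rotation in the `(i, j)` coordinate plane. -/
def planeRotation (d : ℕ) (i j : Fin d) : (EuclideanSpace ℝ (Fin d)) →L[ℝ] (EuclideanSpace ℝ (Fin d)) :=
  (EuclideanSpace.proj i : (EuclideanSpace ℝ (Fin d)) →L[ℝ] ℝ).smulRight (EuclideanSpace.single j 1) -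
    (EuclideanSpace.proj j : (EuclideanSpace ℝ (Fin d)) →L[ℝ] ℝ).smulRight (EuclideanSpace.single i 1)

theorem planeRotation_apply {d : ℕ} (i j : Fin d) (x : EuclideanSpace ℝ (Fin d)) :
    planeRotation d i j x =
      x i • EuclideanSpace.single j (1 : ℝ) - x j • EuclideanSpace.single i (1 : ℝ) := by
  simp [planeRotation]

theorem planeRotation_mem_skewAdjoint {d : ℕ} (i j : Fin d) :
    planeRotation d i j ∈ skewAdjoint ((EuclideanSpace ℝ (Fin d)) →L[ℝ] (EuclideanSpace ℝ (Fin d))) := by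
  rw [skewAdjoint.mem_iff, ContinuousLinearMap.star_eq_adjoint, eq_comm,
    ContinuousLinearMap.eq_adjoint_iff]
  intro x y
  simp only [neg_apply, planeRotation_apply, inner_neg_left, inner_sub_left,
    inner_sub_right, real_inner_smul_left, real_inner_smul_right, EuclideanSpace.inner_single_left,
    EuclideanSpace.inner_single_right]
  simp
  ring

theorem sum_smul_single {d : ℕ} (x : EuclideanSpace ℝ (Fin d)) :
    ∑ i, x i • EuclideanSpace.single i (1 : ℝ) = x := by
  ext k
  simp [Finset.sum_apply, Pi.single_apply]

/-- The algebra behind writing the spherical Laplacian as a sum of squares of rotations, with B as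
Hessian and l as differential. Ordered pairs count every plane twice, hence the factor 2. -/
theorem sum_planeRotation {d : ℕ} (B : (EuclideanSpace ℝ (Fin d)) →L[ℝ] (EuclideanSpace ℝ (Fin d)) →L[ℝ] ℂ) (l : (EuclideanSpace ℝ (Fin d)) →L[ℝ] ℂ) (x : EuclideanSpace ℝ (Fin d)) :
    ∑ i, ∑ j, (B (planeRotation d i j x) (planeRotation d i j x) +
        l (planeRotation d i j (planeRotation d i j x))) =
      2 * ((‖x‖ ^ 2 : ℝ) • ∑ i, B (EuclideanSpace.single i 1) (EuclideanSpace.single i 1) -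
        B x x - ((d : ℂ) - 1) * l x) := by
  set e : Fin d → (EuclideanSpace ℝ (Fin d)) := fun i => EuclideanSpace.single i (1 : ℝ) with he
  have hx : ∑ i, x i • e i = x := sum_smul_single x
  have hBx : B x x = ∑ i, ∑ j, ((x i : ℂ) * x j) * B (e i) (e j) := by
    conv_lhs => rw [← hx]
    rw [Finset.sum_comm]
    simp [map_sum, Finset.mul_sum, mul_assoc, mul_left_comm]
  have hBx' : B x x = ∑ i, ∑ j, ((x i : ℂ) * x j) * B (e j) (e i) := by
    rw [hBx, Finset.sum_comm]
    refine Finset.sum_congr rfl fun i _ => Finset.sum_congr rfl fun j _ => ?_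
    rw [mul_comm (x i : ℂ)]
  have hlx : l x = ∑ i, (x i : ℂ) * l (e i) := by
    conv_lhs => rw [← hx]
    simp [map_sum]
  have hn : (‖x‖ ^ 2 : ℝ) = ∑ i, x i ^ 2 := EuclideanSpace.real_norm_sq_eq x
  have hB : ∀ i j, B (planeRotation d i j x) (planeRotation d i j x) =
      (x i : ℂ) ^ 2 * B (e j) (e j) - ((x i : ℂ) * x j) * B (e i) (e j)
        - ((x i : ℂ) * x j) * B (e j) (e i) + (x j : ℂ) ^ 2 * B (e i) (e i) := by
    intro i j
    rw [planeRotation_apply]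
    simp [he]
    ring
  have hl : ∀ i j, l (planeRotation d i j (planeRotation d i j x)) =
      -- The rotation with i = j is zero; the conditional term cancels what the generic formula
      -- would give there.
      (if i = j then 2 * ((x i : ℂ) * l (e i)) else 0) - (x j : ℂ) * l (e j)
        - (x i : ℂ) * l (e i) := by
    intro i j
    rw [planeRotation_apply i j (planeRotation d i j x), planeRotation_apply]
    by_cases hij : i = j
    · subst hij
      simp
      ring
    · simp [hij, Ne.symm hij, he]
  have h1 : ∑ i, ∑ j, B (planeRotation d i j x) (planeRotation d i j x) =
      2 * ((‖x‖ ^ 2 : ℝ) • ∑ i, B (e i) (e i) - B x x) := by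
    simp_rw [hB, Finset.sum_add_distrib, Finset.sum_sub_distrib]
    rw [← hBx, ← hBx', hn]
    have h2 : ∑ i, ∑ j, (x i : ℂ) ^ 2 * B (e j) (e j) =
        (∑ i, x i ^ 2 : ℝ) • ∑ i, B (e i) (e i) := by
      rw [Complex.real_smul, Complex.ofReal_sum, Finset.sum_mul_sum]
      simp
    have h3 : ∑ i, ∑ j, (x j : ℂ) ^ 2 * B (e i) (e i) =
        (∑ i, x i ^ 2 : ℝ) • ∑ i, B (e i) (e i) := by
      rw [Finset.sum_comm, h2]
    rw [h2, h3]
    ring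
  have h4 : ∑ i, ∑ j, l (planeRotation d i j (planeRotation d i j x)) =
      -2 * (((d : ℂ) - 1) * l x) := by
    simp_rw [hl, Finset.sum_sub_distrib]
    simp only [Finset.sum_ite_eq, Finset.mem_univ, if_true, Finset.sum_const, Finset.card_univ,
      Fintype.card_fin, nsmul_eq_mul, ← Finset.mul_sum, ← hlx]
    ring
  simp_rw [Finset.sum_add_distrib]
  rw [h1, h4]
  ring

/-- The Euler vector field `x · ∇`. -/
abbrev eulerDeriv {d : ℕ} (u : (EuclideanSpace ℝ (Fin d)) → ℂ) : (EuclideanSpace ℝ (Fin d)) → ℂ :=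
  fieldDeriv (ContinuousLinearMap.id ℝ (EuclideanSpace ℝ (Fin d))) u

theorem laplacian_eq_sum {d : ℕ} (u : (EuclideanSpace ℝ (Fin d)) → ℂ) (x : EuclideanSpace ℝ (Fin d)) :
    Laplacian.laplacian u x = ∑ i, fderiv ℝ (fderiv ℝ u) x
      (EuclideanSpace.single i 1) (EuclideanSpace.single i 1) := by
  rw [InnerProductSpace.laplacian_eq_iteratedFDeriv_orthonormalBasis u
    (EuclideanSpace.basisFun (Fin d) ℝ)]
  simp [iteratedFDeriv_two_apply]

/-- The square of the Euler field is D²u(x, x) + Du(x), which absorbs one first-order term and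
lowers d - 1 to d - 2. -/
theorem sum_fieldDeriv_planeRotation {d : ℕ} {u : (EuclideanSpace ℝ (Fin d)) → ℂ} (hu : ContDiff ℝ (⊤ : ℕ∞) u)
    (x : EuclideanSpace ℝ (Fin d)) :
    ∑ i, ∑ j, fieldDeriv (planeRotation d i j) (fieldDeriv (planeRotation d i j) u) x =
      2 * ((‖x‖ ^ 2 : ℝ) • Laplacian.laplacian u x - eulerDeriv (eulerDeriv u) x -
        ((d : ℂ) - 2) * eulerDeriv u x) := by
  simp_rw [fieldDeriv_fieldDeriv _ hu]
  rw [sum_planeRotation, laplacian_eq_sum]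
  simp only [eulerDeriv]
  simp [fieldDeriv]
  ring

theorem ContDiff.laplacian_smooth {d : ℕ} {u : (EuclideanSpace ℝ (Fin d)) → ℂ} (hu : ContDiff ℝ (⊤ : ℕ∞) u) :
    ContDiff ℝ (⊤ : ℕ∞) (Laplacian.laplacian u : (EuclideanSpace ℝ (Fin d)) → ℂ) := by
  have : (Laplacian.laplacian u : (EuclideanSpace ℝ (Fin d)) → ℂ) = fun x => ∑ i, fderiv ℝ (fderiv ℝ u) x
      (EuclideanSpace.single i 1) (EuclideanSpace.single i 1) := funext (laplacian_eq_sum u)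
  rw [this]
  have h2 : ContDiff ℝ (⊤ : ℕ∞) (fderiv ℝ (fderiv ℝ u)) :=
    (hu.fderiv_right (m := (⊤ : ℕ∞)) (by simp)).fderiv_right (by simp)
  exact ContDiff.sum fun i _ => (h2.clm_apply contDiff_const).clm_apply contDiff_const

/-- Green's identity on the unit sphere, the spherical Laplacian being written as
`Δ - (x · ∇)² - (d - 2) x · ∇`. -/
theorem sphere_green {d : ℕ} {u h : (EuclideanSpace ℝ (Fin d)) → ℂ}
    (hu : ContDiff ℝ (⊤ : ℕ∞) u) (hh : ContDiff ℝ (⊤ : ℕ∞) h) :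
    ∫ ω : USphere d, (Laplacian.laplacian u (ω : EuclideanSpace ℝ (Fin d)) - eulerDeriv (eulerDeriv u) ω -
        ((d : ℂ) - 2) * eulerDeriv u ω) * h ω ∂(surfaceMeasure d) =
      ∫ ω : USphere d, u ω * (Laplacian.laplacian h (ω : EuclideanSpace ℝ (Fin d)) - eulerDeriv (eulerDeriv h) ω -
        ((d : ℂ) - 2) * eulerDeriv h ω) ∂(surfaceMeasure d) := by
  have key : ∀ {w : (EuclideanSpace ℝ (Fin d)) → ℂ}, ContDiff ℝ (⊤ : ℕ∞) w → ∀ ω : USphere d,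
      Laplacian.laplacian w (ω : EuclideanSpace ℝ (Fin d)) - eulerDeriv (eulerDeriv w) ω -
        ((d : ℂ) - 2) * eulerDeriv w ω = (1 / 2) * ∑ i, ∑ j,
          fieldDeriv (planeRotation d i j) (fieldDeriv (planeRotation d i j) w) ω := by
    intro w hw ω
    rw [sum_fieldDeriv_planeRotation hw]
    simp
  simp_rw [key hu, key hh, Finset.mul_sum, Finset.sum_mul]
  have hi1 : ∀ i j, Integrable (fun ω : USphere d => 1 / 2 *
      fieldDeriv (planeRotation d i j) (fieldDeriv (planeRotation d i j) u) ω * h ω)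
      (surfaceMeasure d) := fun i j =>
    ((continuous_const.mul ((hu.fieldDeriv _).fieldDeriv _).continuous).mul
      hh.continuous).integrable_sphere
  have hi2 : ∀ i j, Integrable (fun ω : USphere d => u ω * (1 / 2 *
      fieldDeriv (planeRotation d i j) (fieldDeriv (planeRotation d i j) h) ω))
      (surfaceMeasure d) := fun i j =>
    (hu.continuous.mul (continuous_const.mul
      ((hh.fieldDeriv _).fieldDeriv _).continuous)).integrable_sphere
  rw [integral_finsetSum _ fun i _ => integrable_finsetSum _ fun j _ => hi1 i j,
    integral_finsetSum _ fun i _ => integrable_finsetSum _ fun j _ => hi2 i j]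
  refine Finset.sum_congr rfl fun i _ => ?_
  rw [integral_finsetSum _ fun j _ => hi1 i j, integral_finsetSum _ fun j _ => hi2 i j]
  refine Finset.sum_congr rfl fun j _ => ?_
  have := integral_fieldDeriv_twice_mul (planeRotation_mem_skewAdjoint i j) hu hh
  simp_rw [mul_assoc, mul_left_comm (u _)]
  rw [integral_const_mul, integral_const_mul, this]

/-! ### Solid harmonics as eigenfunctions, and their orthogonality. -/

/-- The function on `ℝ^d` defined by a complex polynomial. -/
def polyFun {d : ℕ} (P : MvPolynomial (Fin d) ℂ) (x : EuclideanSpace ℝ (Fin d)) : ℂ :=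
  MvPolynomial.aeval (fun i => (x i : ℂ)) P

theorem restrictToSphere_apply {d : ℕ} (P : MvPolynomial (Fin d) ℂ) (ω : USphere d) :
    restrictToSphere d P ω = polyFun P ω := by
  unfold restrictToSphere polyFun
  induction P using MvPolynomial.induction_on with
  | C a => simp 
  | add p q hp hq => simp [hp, hq]
  | mul_X p i hp => simp [hp, sphereCoord]

theorem hasFDerivAt_polyFun {d : ℕ} (P : MvPolynomial (Fin d) ℂ) (x : EuclideanSpace ℝ (Fin d)) :
    HasFDerivAt (polyFun P) (∑ i, (EuclideanSpace.proj i :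
      (EuclideanSpace ℝ (Fin d)) →L[ℝ] ℝ).smulRight (polyFun (MvPolynomial.pderiv i P) x)) x := by
  induction P using MvPolynomial.induction_on with
  | C a =>
    have : polyFun (MvPolynomial.C a : MvPolynomial (Fin d) ℂ) = fun _ => a := by
      ext; simp [polyFun]
    rw [this]
    have h0 : (∑ i, (EuclideanSpace.proj i : (EuclideanSpace ℝ (Fin d)) →L[ℝ] ℝ).smulRight
        (polyFun (MvPolynomial.pderiv i (MvPolynomial.C a)) x)) = 0 := by
      ext v
      simp [polyFun]
    rw [h0]
    exact hasFDerivAt_const a x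
  | add p q hp hq =>
    have : polyFun (p + q) = fun x => polyFun p x + polyFun q x := by ext; simp [polyFun]
    rw [this]
    convert! hp.add hq using 1
    rw [← Finset.sum_add_distrib]
    congr 1
    ext i v
    simp [polyFun]
  | mul_X p j hp =>
    have : polyFun (p * MvPolynomial.X j) = fun x => polyFun p x * (x j : ℂ) := by
      ext; simp [polyFun]
    rw [this]
    have hj : HasFDerivAt (fun x : EuclideanSpace ℝ (Fin d) => (x j : ℂ))
        (Complex.ofRealCLM.comp (EuclideanSpace.proj j : (EuclideanSpace ℝ (Fin d)) →L[ℝ] ℝ)) x :=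
      (Complex.ofRealCLM.comp
        (EuclideanSpace.proj j : (EuclideanSpace ℝ (Fin d)) →L[ℝ] ℝ)).hasFDerivAt
    convert! hp.mul hj using 1
    ext v
    have h1 : ∀ i, polyFun (MvPolynomial.pderiv i (p * MvPolynomial.X j)) x =
        polyFun (MvPolynomial.pderiv i p) x * (x j : ℂ) +
          if i = j then polyFun p x else 0 := by
      intro i
      rw [Derivation.leibniz, MvPolynomial.pderiv_X]
      by_cases h : i = j
      · subst h; simp [polyFun]; ring
      · simp [polyFun, h, Ne.symm h]; ring
    simp only [h1]
    simp [sum_apply, Finset.sum_add_distrib, Finset.mul_sum]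
    rw [add_comm, mul_comm]
    congr 1
    exact Finset.sum_congr rfl fun i _ => by ring

theorem fderiv_polyFun {d : ℕ} (P : MvPolynomial (Fin d) ℂ) (x v : EuclideanSpace ℝ (Fin d)) :
    fderiv ℝ (polyFun P) x v = ∑ i, (v i : ℂ) * polyFun (MvPolynomial.pderiv i P) x := by
  rw [(hasFDerivAt_polyFun P x).fderiv]
  simp [sum_apply]

theorem fderiv_polyFun_single {d : ℕ} (P : MvPolynomial (Fin d) ℂ) (x : EuclideanSpace ℝ (Fin d))
    (i : Fin d) :
    fderiv ℝ (polyFun P) x (EuclideanSpace.single i 1) = polyFun (MvPolynomial.pderiv i P) x := by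
  rw [fderiv_polyFun, Finset.sum_eq_single i]
  · simp
  · intro j _ hj
    simp [hj]
  · simp

theorem contDiff_polyFun {d : ℕ} (P : MvPolynomial (Fin d) ℂ) :
    ContDiff ℝ (⊤ : ℕ∞) (polyFun P) := by
  unfold polyFun
  induction P using MvPolynomial.induction_on with
  | C a => simpa [MvPolynomial.aeval_C] using contDiff_const
  | add p q hp hq => simpa using hp.add hq
  | mul_X p j hp =>
    simp only [map_mul, MvPolynomial.aeval_X]
    exact hp.mul (Complex.ofRealCLM.comp
        (EuclideanSpace.proj j : (EuclideanSpace ℝ (Fin d)) →L[ℝ] ℝ)).contDiff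

theorem laplacian_polyFun {d : ℕ} (P : MvPolynomial (Fin d) ℂ) (x : EuclideanSpace ℝ (Fin d)) :
    Laplacian.laplacian (polyFun P) x = polyFun (polyLaplacian d P) x := by
  rw [laplacian_eq_sum]
  have h1 : Differentiable ℝ (fderiv ℝ (polyFun P)) :=
    ((contDiff_polyFun P).fderiv_right (m := (⊤ : ℕ∞)) (by simp)).differentiable (by simp)
  have h2 : ∀ v w, fderiv ℝ (fderiv ℝ (polyFun P)) x v w =
      fderiv ℝ (fun x => fderiv ℝ (polyFun P) x w) x v := by
    intro v w
    rw [fderiv_clm_apply (h1 x) (differentiableAt_const _)]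
    simp
  have h3 : ∀ i, (fun x => fderiv ℝ (polyFun P) x (EuclideanSpace.single i 1)) =
      polyFun (MvPolynomial.pderiv i P) := by
    intro i
    ext y
    exact fderiv_polyFun_single P y i
  simp_rw [h2, h3, fderiv_polyFun_single]
  simp [polyLaplacian, polyFun, LinearMap.sum_apply]

theorem eulerDeriv_polyFun {d n : ℕ} {P : MvPolynomial (Fin d) ℂ} (hP : P.IsHomogeneous n) :
    eulerDeriv (polyFun P) = fun x => (n : ℂ) * polyFun P x := by
  ext x
  have h := congrArg (fun Q => polyFun Q x) hP.sum_X_mul_pderiv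
  simp only [eulerDeriv, fieldDeriv, fderiv_polyFun]
  simpa [polyFun] using h

theorem eulerDeriv_const_mul {d : ℕ} (c : ℂ) (u : EuclideanSpace ℝ (Fin d) → ℂ)
    (hu : Differentiable ℝ u) (x : EuclideanSpace ℝ (Fin d)) :
    eulerDeriv (fun x => c * u x) x = c * eulerDeriv u x := by
  simp only [eulerDeriv, fieldDeriv]
  rw [fderiv_const_mul (hu x)]
  simp

theorem polyFun_smooth_differentiable {d : ℕ} (P : MvPolynomial (Fin d) ℂ) :
    Differentiable ℝ (polyFun P) := (contDiff_polyFun P).differentiable (by simp)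

/-- A function is tested against a solid harmonic: the spherical Laplacian becomes its
eigenvalue `-n (n + d - 2)`. -/
theorem integral_sphere_harmonic {d n : ℕ} {u : EuclideanSpace ℝ (Fin d) → ℂ}
    (hu : ContDiff ℝ (⊤ : ℕ∞) u) {P : MvPolynomial (Fin d) ℂ} (hP : P ∈ solidHarmonics d n) :
    ∫ ω : USphere d, (Laplacian.laplacian u (ω : EuclideanSpace ℝ (Fin d)) -
        eulerDeriv (eulerDeriv u) ω - ((d : ℂ) - 2) * eulerDeriv u ω) * polyFun P ω
          ∂(surfaceMeasure d) =
      -((n : ℂ) * (n + d - 2)) * ∫ ω : USphere d, u ω * polyFun P ω ∂(surfaceMeasure d) := by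
  rw [sphere_green hu (contDiff_polyFun P), ← integral_const_mul]
  congr 1
  ext ω
  have h1 : polyLaplacian d P = 0 := hP.2
  rw [laplacian_polyFun, h1, eulerDeriv_polyFun hP.1,
    eulerDeriv_const_mul _ _ (polyFun_smooth_differentiable P), eulerDeriv_polyFun hP.1]
  simp [polyFun]
  ring

theorem integral_solidHarmonics_mul {d n m : ℕ} (hd : 2 ≤ d) (hnm : n ≠ m)
    {P Q : MvPolynomial (Fin d) ℂ}
    (hP : P ∈ solidHarmonics d n) (hQ : Q ∈ solidHarmonics d m) :
    ∫ ω : USphere d, polyFun P ω * polyFun Q ω ∂(surfaceMeasure d) = 0 := by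
  have h1 := integral_sphere_harmonic (contDiff_polyFun P) hQ
  have h2 : polyLaplacian d P = 0 := hP.2
  simp_rw [laplacian_polyFun, h2, eulerDeriv_polyFun hP.1,
    eulerDeriv_const_mul _ _ (polyFun_smooth_differentiable P), eulerDeriv_polyFun hP.1] at h1
  have h3 : ∀ ω : USphere d, (polyFun (0 : MvPolynomial (Fin d) ℂ) (ω : EuclideanSpace ℝ (Fin d)) -
      (n : ℂ) * (n * polyFun P ω) - ((d : ℂ) - 2) * (n * polyFun P ω)) * polyFun Q ω =
      -((n : ℂ) * (n + d - 2)) * (polyFun P ω * polyFun Q ω) := by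
    intro ω
    simp [polyFun]
    ring
  simp_rw [h3] at h1
  rw [integral_const_mul] at h1
  -- The difference of the eigenvalues of degrees n and m. The second factor is positive because d ≥
  -- 2 and n, m are not both 0.
  have h4 : ((n : ℂ) - m) * ((n : ℂ) + m + d - 2) ≠ 0 := by
    obtain ⟨k, rfl⟩ := Nat.exists_eq_add_of_le hd
    refine mul_ne_zero (sub_ne_zero.mpr (by exact_mod_cast hnm)) ?_
    have : (n : ℂ) + m + (2 + k : ℕ) - 2 = ((n + m + k : ℕ) : ℂ) := by push_cast; ring
    rw [this, Nat.cast_ne_zero]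
    omega
  have h5 : (((n : ℂ) - m) * ((n : ℂ) + m + d - 2)) *
      ∫ ω : USphere d, polyFun P ω * polyFun Q ω ∂(surfaceMeasure d) = 0 := by
    linear_combination -h1
  exact (mul_eq_zero.mp h5).resolve_left h4

theorem polyFun_map_conj {d : ℕ} (P : MvPolynomial (Fin d) ℂ) (x : EuclideanSpace ℝ (Fin d)) :
    polyFun (MvPolynomial.map (starRingEnd ℂ) P) x = (starRingEnd ℂ) (polyFun P x) := by
  unfold polyFun
  induction P using MvPolynomial.induction_on with
  | C a => simp
  | add p q hp hq => simp only [map_add, hp, hq]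
  | mul_X p i hp =>
    simp only [map_mul, hp, MvPolynomial.map_X, MvPolynomial.aeval_X, Complex.conj_ofReal]

/-- The Laplacian has real coefficients. This converts the bilinear integral identities into
statements about the Hermitian inner product. -/
theorem map_conj_mem_solidHarmonics {d n : ℕ} {P : MvPolynomial (Fin d) ℂ}
    (hP : P ∈ solidHarmonics d n) :
    MvPolynomial.map (starRingEnd ℂ) P ∈ solidHarmonics d n := by
  refine ⟨MvPolynomial.IsHomogeneous.map hP.1 _, ?_⟩
  have h1 : polyLaplacian d P = 0 := hP.2
  change polyLaplacian d _ = 0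
  have h2 : polyLaplacian d (MvPolynomial.map (starRingEnd ℂ) P) =
      MvPolynomial.map (starRingEnd ℂ) (polyLaplacian d P) := by
    simp [polyLaplacian, LinearMap.sum_apply, MvPolynomial.pderiv_map]
  rw [h2, h1, map_zero]

theorem mem_sphericalHarmonics_iff {d n : ℕ} {f : Lp ℂ 2 (surfaceMeasure d)} :
    f ∈ sphericalHarmonics d n ↔ ∃ P ∈ solidHarmonics d n,
      ContinuousMap.toLp (E := ℂ) 2 (surfaceMeasure d) ℂ (restrictToSphere d P) = f := by
  simp [sphericalHarmonics]

theorem inner_toLp_restrictToSphere {d : ℕ} (P : MvPolynomial (Fin d) ℂ) (f : C(USphere d, ℂ)) :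
    inner ℂ (ContinuousMap.toLp (E := ℂ) 2 (surfaceMeasure d) ℂ (restrictToSphere d P))
      (ContinuousMap.toLp (E := ℂ) 2 (surfaceMeasure d) ℂ f) =
    ∫ ω : USphere d, f ω * polyFun (MvPolynomial.map (starRingEnd ℂ) P) ω
      ∂(surfaceMeasure d) := by
  rw [ContinuousMap.inner_toLp]
  simp_rw [restrictToSphere_apply, polyFun_map_conj]

theorem orthogonalFamily_sphericalHarmonics {d : ℕ} (hd : 2 ≤ d) :
    OrthogonalFamily ℂ (fun n => sphericalHarmonics d n)
      fun n => (sphericalHarmonics d n).subtypeₗᵢ := by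
  rintro n m hnm ⟨f, hf⟩ ⟨g, hg⟩
  obtain ⟨P, hP, rfl⟩ := mem_sphericalHarmonics_iff.mp hf
  obtain ⟨Q, hQ, rfl⟩ := mem_sphericalHarmonics_iff.mp hg
  change inner ℂ (ContinuousMap.toLp (E := ℂ) 2 (surfaceMeasure d) ℂ (restrictToSphere d P))
    (ContinuousMap.toLp (E := ℂ) 2 (surfaceMeasure d) ℂ (restrictToSphere d Q)) = 0
  rw [inner_toLp_restrictToSphere]
  simp_rw [restrictToSphere_apply]
  exact integral_solidHarmonics_mul hd hnm.symm hQ (map_conj_mem_solidHarmonics hP)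

/-! ### Fischer decomposition and completeness of spherical harmonics. -/

section Fischer

open MvPolynomial

/-- The polynomial `∑ i, xᵢ²`. -/
def normSqPoly (d : ℕ) : MvPolynomial (Fin d) ℂ := ∑ i, X i ^ 2

theorem isHomogeneous_normSqPoly (d : ℕ) : (normSqPoly d).IsHomogeneous 2 :=
  IsHomogeneous.sum _ _ _ fun i _ => by simpa using (isHomogeneous_X ℂ i).pow 2

theorem polyLaplacian_apply {d : ℕ} (P : MvPolynomial (Fin d) ℂ) :
    polyLaplacian d P = ∑ i, pderiv i (pderiv i P) := by
  simp [polyLaplacian, LinearMap.sum_apply]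

/-- Leibniz: Δ|x|² gives 2d, and the cross term is 4 x·∇F = 4N F by Euler's identity. -/
theorem polyLaplacian_normSqPoly_mul {d N : ℕ} {F : MvPolynomial (Fin d) ℂ}
    (hF : F.IsHomogeneous N) :
    polyLaplacian d (normSqPoly d * F) =
      (2 * d + 4 * N) • F + normSqPoly d * polyLaplacian d F := by
  have h1 : ∀ i, pderiv i (normSqPoly d) = 2 * X i := by
    intro i
    simp [normSqPoly, map_sum, Derivation.leibniz_pow, pderiv_X, Pi.single_apply]
  have h2 : ∀ i, pderiv i (pderiv i (normSqPoly d * F)) =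
      2 * F + 4 * (X i * pderiv i F) + normSqPoly d * pderiv i (pderiv i F) := by
    intro i
    have h3 : pderiv i (2 * X i : MvPolynomial (Fin d) ℂ) = 2 := by
      have h4 : (2 : MvPolynomial (Fin d) ℂ) = C 2 := (map_ofNat C 2).symm
      rw [h4, pderiv_C_mul, pderiv_X_self, mul_one]
    rw [Derivation.leibniz, h1, map_add]
    simp only [smul_eq_mul]
    rw [Derivation.leibniz, Derivation.leibniz, h1, h3]
    simp only [smul_eq_mul]
    ring
  rw [polyLaplacian_apply, polyLaplacian_apply]
  simp_rw [h2, Finset.sum_add_distrib, ← Finset.mul_sum]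
  rw [hF.sum_X_mul_pderiv]
  simp [nsmul_eq_mul]
  ring

/-- The span of the products `|x|^(2j) h` of total degree `N`, with `h` a solid harmonic. -/
def fischerSpan (d N : ℕ) : Submodule ℂ (MvPolynomial (Fin d) ℂ) :=
  Submodule.span ℂ {F | ∃ j k h, 2 * j + k = N ∧ h ∈ solidHarmonics d k ∧ F = normSqPoly d ^ j * h}

theorem fischerSpan_le (d N : ℕ) : fischerSpan d N ≤ homogeneousSubmodule (Fin d) ℂ N := by
  refine Submodule.span_le.mpr ?_
  rintro _ ⟨j, k, h, rfl, hh, rfl⟩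
  exact ((isHomogeneous_normSqPoly d).pow j).mul hh.1

theorem polyLaplacian_normSqPoly_pow_mul {d k : ℕ} (hd : 0 < d) {h : MvPolynomial (Fin d) ℂ}
    (hh : h ∈ solidHarmonics d k) (j : ℕ) :
    ∃ c : ℕ, 0 < c ∧ polyLaplacian d (normSqPoly d ^ (j + 1) * h) = c • (normSqPoly d ^ j * h) := by
  have h0 : polyLaplacian d h = 0 := hh.2
  induction j with
  | zero =>
    refine ⟨2 * d + 4 * k, by omega, ?_⟩
    rw [zero_add, pow_one, polyLaplacian_normSqPoly_mul hh.1, h0]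
    simp
  | succ j ih =>
    obtain ⟨c, -, hc⟩ := ih
    have hhom : (normSqPoly d ^ (j + 1) * h).IsHomogeneous (2 * (j + 1) + k) :=
      ((isHomogeneous_normSqPoly d).pow (j + 1)).mul hh.1
    refine ⟨2 * d + 4 * (2 * (j + 1) + k) + c, by omega, ?_⟩
    rw [pow_succ' _ (j + 1), mul_assoc, polyLaplacian_normSqPoly_mul hhom, hc]
    simp only [nsmul_eq_mul]
    push_cast
    ring

/-- Each generator is an eigenvector of F ↦ Δ(|x|² F) with a positive eigenvalue, so this map is
onto the span. -/
theorem exists_polyLaplacian_eq {d N : ℕ} (hd : 0 < d) {F : MvPolynomial (Fin d) ℂ}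
    (hF : F ∈ fischerSpan d N) :
    ∃ Q ∈ fischerSpan d N, polyLaplacian d (normSqPoly d * Q) = F := by
  induction hF using Submodule.span_induction with
  | mem F hF =>
    obtain ⟨j, k, h, hN, hh, rfl⟩ := hF
    obtain ⟨c, hc, hcj⟩ := polyLaplacian_normSqPoly_pow_mul hd hh j
    refine ⟨(c : ℂ)⁻¹ • (normSqPoly d ^ j * h),
      Submodule.smul_mem _ _ (Submodule.subset_span ⟨j, k, h, hN, hh, rfl⟩), ?_⟩
    rw [mul_smul_comm, map_smul, ← mul_assoc, ← pow_succ', hcj, ← Nat.cast_smul_eq_nsmul ℂ,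
      smul_smul, inv_mul_cancel₀ (by exact_mod_cast hc.ne'), one_smul]
  | zero => exact ⟨0, Submodule.zero_mem _, by simp⟩
  | add x y _ _ hx hy =>
    obtain ⟨Q, hQ, hQx⟩ := hx
    obtain ⟨R, hR, hRy⟩ := hy
    exact ⟨Q + R, Submodule.add_mem _ hQ hR, by rw [mul_add, map_add, hQx, hRy]⟩
  | smul a x _ hx =>
    obtain ⟨Q, hQ, hQx⟩ := hx
    exact ⟨a • Q, Submodule.smul_mem _ _ hQ, by rw [mul_smul_comm, map_smul, hQx]⟩

theorem normSqPoly_mul_mem_fischerSpan {d N : ℕ} {F : MvPolynomial (Fin d) ℂ}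
    (hF : F ∈ fischerSpan d N) : normSqPoly d * F ∈ fischerSpan d (N + 2) := by
  induction hF using Submodule.span_induction with
  | mem F hF =>
    obtain ⟨j, k, h, hN, hh, rfl⟩ := hF
    exact Submodule.subset_span ⟨j + 1, k, h, by omega, hh, by ring⟩
  | zero => simp
  | add x y _ _ hx hy => rw [mul_add]; exact Submodule.add_mem _ hx hy
  | smul a x _ hx => rw [mul_smul_comm]; exact Submodule.smul_mem _ _ hx

theorem mem_fischerSpan_of_mem_solidHarmonics {d N : ℕ} {F : MvPolynomial (Fin d) ℂ}
    (hF : F ∈ solidHarmonics d N) : F ∈ fischerSpan d N :=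
  Submodule.subset_span ⟨0, N, F, by omega, hF, by simp⟩

/-- Fischer's decomposition. -/
theorem homogeneousSubmodule_le_fischerSpan {d : ℕ} (hd : 0 < d) (N : ℕ) :
    homogeneousSubmodule (Fin d) ℂ N ≤ fischerSpan d N := by
  induction N using Nat.strong_induction_on with
  | _ N ih =>
  intro P hP
  have hP : P.IsHomogeneous N := hP
  have hlap : (polyLaplacian d P).IsHomogeneous (N - 1 - 1) := by
    rw [polyLaplacian_apply]
    exact IsHomogeneous.sum _ _ _ fun i _ => hP.pderiv.pderiv
  rcases lt_or_ge N 2 with hN | hN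
  · refine mem_fischerSpan_of_mem_solidHarmonics ⟨hP, ?_⟩
    change polyLaplacian d _ = 0
    rw [polyLaplacian_apply]
    refine Finset.sum_eq_zero fun i _ => ?_
    have h1 : (pderiv i P).IsHomogeneous 0 := by
      have := hP.pderiv (i := i)
      rwa [show N - 1 = 0 by omega] at this
    rw [← totalDegree_zero_iff_isHomogeneous, totalDegree_eq_zero_iff_eq_C] at h1
    rw [h1, pderiv_C]
  · obtain ⟨M, rfl⟩ := Nat.exists_eq_add_of_le' hN
    -- Solving Δ(|x|² Q) = ΔP makes P - |x|² Q harmonic, while |x|² Q already lies in the span.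
    obtain ⟨Q, hQ, hQP⟩ := exists_polyLaplacian_eq hd (ih M (by omega) hlap)
    have hh : P - normSqPoly d * Q ∈ solidHarmonics d (M + 2) := by
      refine ⟨Submodule.sub_mem _ hP (fischerSpan_le d _ (normSqPoly_mul_mem_fischerSpan hQ)), ?_⟩
      change polyLaplacian d _ = 0
      rw [map_sub, hQP, sub_self]
    have := Submodule.add_mem _ (mem_fischerSpan_of_mem_solidHarmonics hh)
      (normSqPoly_mul_mem_fischerSpan hQ)
    simpa using this

theorem restrictToSphere_normSqPoly (d : ℕ) : restrictToSphere d (normSqPoly d) = 1 := by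
  ext ω
  rw [restrictToSphere_apply]
  have h : ‖(ω : EuclideanSpace ℝ (Fin d))‖ ^ 2 = ∑ i, (ω : EuclideanSpace ℝ (Fin d)) i ^ 2 :=
    EuclideanSpace.real_norm_sq_eq _
  have h1 : ‖(ω : EuclideanSpace ℝ (Fin d))‖ = 1 := by simp
  rw [h1, one_pow] at h
  simp only [polyFun, normSqPoly, map_sum, map_pow, aeval_X, ContinuousMap.one_apply]
  exact_mod_cast h.symm

end Fischer

/-- On the sphere |x|² = 1, so every Fischer generator |x|^(2j) h restricts to the harmonic h. -/
theorem toLp_restrictToSphere_mem {d : ℕ} (hd : 0 < d) (P : MvPolynomial (Fin d) ℂ) :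
    ContinuousMap.toLp (E := ℂ) 2 (surfaceMeasure d) ℂ (restrictToSphere d P) ∈
      ⨆ n, sphericalHarmonics d n := by
  set T : MvPolynomial (Fin d) ℂ →ₗ[ℂ] Lp ℂ 2 (surfaceMeasure d) :=
    (ContinuousMap.toLp (E := ℂ) 2 (surfaceMeasure d) ℂ).toLinearMap ∘ₗ
      (restrictToSphere d).toLinearMap with hT
  have hT' : ∀ Q, T Q =
    ContinuousMap.toLp (E := ℂ) 2 (surfaceMeasure d) ℂ (restrictToSphere d Q) := fun _ => rfl
  rw [← hT']
  have key : ∀ N, fischerSpan d N ≤ (⨆ n, sphericalHarmonics d n).comap T := by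
    intro N
    refine Submodule.span_le.mpr ?_
    rintro _ ⟨j, k, h, -, hh, rfl⟩
    simp only [SetLike.mem_coe, Submodule.mem_comap]
    rw [hT', map_mul, map_pow, restrictToSphere_normSqPoly, one_pow, one_mul]
    exact Submodule.mem_iSup_of_mem k (mem_sphericalHarmonics_iff.mpr ⟨h, hh, rfl⟩)
  rw [← MvPolynomial.sum_homogeneousComponent P, map_sum]
  exact Submodule.sum_mem _ fun i _ => key i (homogeneousSubmodule_le_fischerSpan hd i
    (MvPolynomial.homogeneousComponent_mem i P))

/-- The restrictions of polynomials to the sphere, as a star subalgebra. -/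
def spherePolynomials (d : ℕ) : StarSubalgebra ℂ C(USphere d, ℂ) where
  toSubalgebra := (restrictToSphere d).range
  star_mem' := by
    rintro _ ⟨P, rfl⟩
    refine ⟨MvPolynomial.map (starRingEnd ℂ) P, ?_⟩
    ext ω
    change restrictToSphere d _ ω = star (restrictToSphere d P ω)
    rw [restrictToSphere_apply, restrictToSphere_apply, polyFun_map_conj]
    rfl

/-- Stone–Weierstrass: polynomials are stable under conjugation and the coordinates separate points.
-/
theorem denseRange_restrictToSphere (d : ℕ) : DenseRange (restrictToSphere d) := by
  have h := ContinuousMap.starSubalgebra_topologicalClosure_eq_top_of_separatesPoints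
    (spherePolynomials d) (by
      intro x y hxy
      obtain ⟨i, hi⟩ : ∃ i, (x : EuclideanSpace ℝ (Fin d)) i ≠ (y : EuclideanSpace ℝ (Fin d)) i := by
        by_contra hcon
        push Not at hcon
        exact hxy (Subtype.ext (PiLp.ext hcon))
      refine ⟨_, ⟨restrictToSphere d (MvPolynomial.X i), ⟨_, rfl⟩, rfl⟩, ?_⟩
      change restrictToSphere d (MvPolynomial.X i) x ≠ restrictToSphere d (MvPolynomial.X i) y
      rw [restrictToSphere_apply, restrictToSphere_apply]
      simpa [polyFun] using hi)
  intro f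
  have hf : f ∈ (spherePolynomials d).topologicalClosure := by rw [h]; trivial
  exact hf

theorem hasSum_harmonicProj {d : ℕ} (hd : 2 ≤ d) (f : Lp ℂ 2 (surfaceMeasure d)) :
    HasSum (fun n => harmonicProj d n f) f := by
  have hort := orthogonalFamily_sphericalHarmonics hd
  have hdense : DenseRange fun P => ContinuousMap.toLp (E := ℂ) 2 (surfaceMeasure d) ℂ
      (restrictToSphere d P) :=
    (ContinuousMap.toLp_denseRange ℂ (surfaceMeasure d) ℂ (by norm_num)).comp
      (denseRange_restrictToSphere d) (ContinuousLinearMap.continuous _)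
  have htot : ⊤ ≤ (⨆ n, sphericalHarmonics d n).topologicalClosure := by
    intro g _
    refine closure_mono ?_ (hdense g)
    rintro _ ⟨P, rfl⟩
    exact toLp_restrictToSphere_mem (by omega) P
  have hH := IsHilbertSum.mkInternal (fun n => sphericalHarmonics d n) hort htot
  have hs := hH.hasSum_linearIsometryEquiv_symm (hH.linearIsometryEquiv f)
  rw [LinearIsometryEquiv.symm_apply_apply] at hs
  convert! hs using 1
  funext n
  -- Projecting the Hilbert-sum expansion termwise keeps only degree n, which identifies its
  -- components with the projections.
  have hn := (harmonicProj d n).hasSum hs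
  refine hn.unique ?_
  set w := hH.linearIsometryEquiv f
  have h1 : harmonicProj d n ((sphericalHarmonics d n).subtypeₗᵢ (w n)) =
      (sphericalHarmonics d n).subtypeₗᵢ (w n) :=
    Submodule.starProjection_eq_self_iff.mpr (w n).2
  rw [← h1]
  refine hasSum_single n fun m hm => ?_
  refine (Submodule.starProjection_apply_eq_zero_iff _).mpr ?_
  intro v hv
  exact hort hm.symm ⟨v, hv⟩ (w m)

/-! ### Harmonic coefficients on spheres and their ODE in t = log r. -/

theorem fderiv_comp_dilation {d : ℕ} {F : Type*} [NormedAddCommGroup F] [NormedSpace ℝ F]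
    {u : EuclideanSpace ℝ (Fin d) → F} (hu : Differentiable ℝ u) (r : ℝ)
    (x : EuclideanSpace ℝ (Fin d)) :
    fderiv ℝ (fun x => u (r • x)) x = r • fderiv ℝ u (r • x) := by
  have h := (hu (r • x)).hasFDerivAt.comp x ((hasFDerivAt_id x).const_smul r)
  have h' : HasFDerivAt (fun x => u (r • x)) _ x := h
  rw [h'.fderiv]
  ext v
  simp

theorem laplacian_comp_dilation {d : ℕ} {u : EuclideanSpace ℝ (Fin d) → ℂ}
    (hu : ContDiff ℝ (⊤ : ℕ∞) u) (r : ℝ) (x : EuclideanSpace ℝ (Fin d)) :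
    Laplacian.laplacian (fun x => u (r • x)) x = (r ^ 2 : ℝ) • Laplacian.laplacian u (r • x) := by
  have h1 : Differentiable ℝ u := hu.differentiable (by simp)
  have h2 : Differentiable ℝ (fderiv ℝ u) :=
    (hu.fderiv_right (m := (⊤ : ℕ∞)) (by simp)).differentiable (by simp)
  rw [laplacian_eq_sum, laplacian_eq_sum, Finset.smul_sum]
  refine Finset.sum_congr rfl fun i _ => ?_
  have h3 : fderiv ℝ (fun x => u (r • x)) = fun x => r • fderiv ℝ u (r • x) :=
    funext fun x => fderiv_comp_dilation h1 r x
  have h4 : Differentiable ℝ fun x => fderiv ℝ u (r • x) :=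
    h2.comp (differentiable_id.const_smul r)
  rw [h3, fderiv_fun_const_smul (h4 x), fderiv_comp_dilation h2]
  simp only [_root_.smul_apply, smul_smul]
  rw [sq]

theorem eulerDeriv_comp_dilation {d : ℕ} {u : EuclideanSpace ℝ (Fin d) → ℂ}
    (hu : Differentiable ℝ u) (r : ℝ) :
    eulerDeriv (fun x => u (r • x)) = fun x => eulerDeriv u (r • x) := by
  ext x
  simp only [eulerDeriv, fieldDeriv]
  rw [fderiv_comp_dilation hu]
  simp

/-- In logarithmic radius the Euler field is d/dt. -/
theorem hasDerivAt_integral_dilation {d : ℕ} {u h : EuclideanSpace ℝ (Fin d) → ℂ}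
    (hu : ContDiff ℝ (⊤ : ℕ∞) u) (hh : Continuous h) (t : ℝ) :
    HasDerivAt (fun t => ∫ ω : USphere d, u (Real.exp t • (ω : EuclideanSpace ℝ (Fin d))) * h ω
        ∂(surfaceMeasure d))
      (∫ ω : USphere d, eulerDeriv u (Real.exp t • (ω : EuclideanSpace ℝ (Fin d))) * h ω
        ∂(surfaceMeasure d)) t := by
  have hd : ∀ x : EuclideanSpace ℝ (Fin d), ∀ t : ℝ,
      HasDerivAt (fun t => u (Real.exp t • x)) (eulerDeriv u (Real.exp t • x)) t := by
    intro x t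
    have h1 : HasDerivAt (fun t => Real.exp t • x) (Real.exp t • x) t :=
      (Real.hasDerivAt_exp t).smul_const x
    exact ((hu.differentiable (by simp)) _).hasFDerivAt.comp_hasDerivAt t h1
  have hE := (hu.fieldDeriv (ContinuousLinearMap.id ℝ _)).continuous
  have hhc : Continuous fun ω : USphere d => h ω := hh.comp continuous_subtype_val
  refine hasDerivAt_integral_of_compactSpace (surfaceMeasure d)
    (F := fun t ω => u (Real.exp t • (ω : EuclideanSpace ℝ (Fin d))) * h ω)
    (F' := fun t ω => eulerDeriv u (Real.exp t • (ω : EuclideanSpace ℝ (Fin d))) * h ω)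
    ?_ ?_ ?_ t
  · intro t
    exact (hu.continuous.comp (by fun_prop)).mul hhc
  · exact (hE.comp (by fun_prop : Continuous fun x : ℝ × USphere d =>
      Real.exp x.1 • (x.2 : EuclideanSpace ℝ (Fin d)))).mul (hhc.comp continuous_snd)
  · intro t ω
    exact (hd ω t).mul_const _

/-- The ODE satisfied by the harmonic coefficients of `u` on spheres, in logarithmic radius. -/
theorem integral_dilation_laplacian {d n : ℕ} {u : EuclideanSpace ℝ (Fin d) → ℂ}
    (hu : ContDiff ℝ (⊤ : ℕ∞) u) {P : MvPolynomial (Fin d) ℂ} (hP : P ∈ solidHarmonics d n)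
    (r : ℝ) :
    ∫ ω : USphere d, ((r ^ 2 : ℝ) • Laplacian.laplacian u (r • (ω : EuclideanSpace ℝ (Fin d)))) *
        polyFun P ω ∂(surfaceMeasure d) =
      ∫ ω : USphere d, eulerDeriv (eulerDeriv u) (r • (ω : EuclideanSpace ℝ (Fin d))) *
        polyFun P ω ∂(surfaceMeasure d) +
      ((d : ℂ) - 2) * ∫ ω : USphere d, eulerDeriv u (r • (ω : EuclideanSpace ℝ (Fin d))) *
        polyFun P ω ∂(surfaceMeasure d) -
      ((n : ℂ) * (n + d - 2)) * ∫ ω : USphere d, u (r • (ω : EuclideanSpace ℝ (Fin d))) *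
        polyFun P ω ∂(surfaceMeasure d) := by
  have hE := hu.fieldDeriv (ContinuousLinearMap.id ℝ _)
  have hEE := hE.fieldDeriv (ContinuousLinearMap.id ℝ _)
  have hur : ContDiff ℝ (⊤ : ℕ∞) fun x : EuclideanSpace ℝ (Fin d) => u (r • x) :=
    hu.comp (contDiff_id.const_smul r)
  have h := integral_sphere_harmonic hur hP
  simp_rw [laplacian_comp_dilation hu, eulerDeriv_comp_dilation (hu.differentiable (by simp)) r] at h
  rw [eulerDeriv_comp_dilation (hE.differentiable (by simp)) r] at h
  have hPc := (contDiff_polyFun P).continuous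
  have hΔ : Continuous fun x : EuclideanSpace ℝ (Fin d) =>
      (r ^ 2 : ℝ) • Laplacian.laplacian u (r • x) :=
    Continuous.const_smul (hu.laplacian_smooth.continuous.comp (continuous_const_smul r)) (r ^ 2)
  have i1 : Integrable (fun ω : USphere d =>
      ((r ^ 2 : ℝ) • Laplacian.laplacian u (r • (ω : EuclideanSpace ℝ (Fin d)))) * polyFun P ω)
      (surfaceMeasure d) :=
    Continuous.integrable_sphere (f := fun x => ((r ^ 2 : ℝ) • Laplacian.laplacian u (r • x)) *
      polyFun P x) (hΔ.mul hPc)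
  have i2 : Integrable (fun ω : USphere d =>
      eulerDeriv (eulerDeriv u) (r • (ω : EuclideanSpace ℝ (Fin d))) * polyFun P ω)
      (surfaceMeasure d) :=
    Continuous.integrable_sphere (f := fun x => eulerDeriv (eulerDeriv u) (r • x) *
      polyFun P x) ((hEE.continuous.comp (continuous_const_smul r)).mul hPc)
  have i3 : Integrable (fun ω : USphere d =>
      ((d : ℂ) - 2) * (eulerDeriv u (r • (ω : EuclideanSpace ℝ (Fin d))) * polyFun P ω))
      (surfaceMeasure d) :=
    Continuous.integrable_sphere (f := fun x => ((d : ℂ) - 2) * (eulerDeriv u (r • x) *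
      polyFun P x)) (continuous_const.mul ((hE.continuous.comp (continuous_const_smul r)).mul hPc))
  simp_rw [sub_mul _ _ (polyFun P _), mul_assoc] at h
  have i12 := i1.sub i2
  simp only [Pi.sub_def] at i12
  rw [integral_sub i12 i3, integral_sub i1 i2, integral_const_mul] at h
  linear_combination h

/-- The function `t ↦ (ω ↦ w (e^t ω))`. -/
def expDilate {d : ℕ} (w : C(EuclideanSpace ℝ (Fin d), ℂ)) : C(ℝ, C(USphere d, ℂ)) :=
  ContinuousMap.curry
    ⟨fun x : ℝ × USphere d => w (Real.exp x.1 • (x.2 : EuclideanSpace ℝ (Fin d))), by fun_prop⟩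

theorem expDilate_apply {d : ℕ} (w : C(EuclideanSpace ℝ (Fin d), ℂ)) (t : ℝ) (ω : USphere d) :
    expDilate w t ω = w (Real.exp t • (ω : EuclideanSpace ℝ (Fin d))) := rfl

theorem hasCompactSupport_expDilate {d : ℕ} {w : C(EuclideanSpace ℝ (Fin d), ℂ)}
    (hw : HasCompactSupport w) (h0 : (0 : EuclideanSpace ℝ (Fin d)) ∉ tsupport w) :
    HasCompactSupport (expDilate w) := by
  obtain ⟨R, hR⟩ := hw.isCompact.isBounded.exists_norm_le
  obtain ⟨ε, hε, hball⟩ := Metric.isOpen_iff.mp (isClosed_tsupport w).isOpen_compl 0 h0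
  -- The support lies in an annulus ε ≤ |x| ≤ R; the maximum with 1 only keeps the logarithm's
  -- argument positive.
  refine HasCompactSupport.intro (isCompact_Icc (a := Real.log ε) (b := Real.log (max R 1))) ?_
  intro t ht
  ext ω
  rw [expDilate_apply]
  by_contra hne
  have hmem : Real.exp t • (ω : EuclideanSpace ℝ (Fin d)) ∈ tsupport w := subset_tsupport _ hne
  have hnorm : ‖Real.exp t • (ω : EuclideanSpace ℝ (Fin d))‖ = Real.exp t := by
    simp [norm_smul]
  apply ht
  constructor
  · by_contra hlt
    push Not at hlt
    refine hball ?_ hmem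
    rw [mem_ball_zero_iff, hnorm]
    exact (Real.lt_log_iff_exp_lt hε).mp hlt
  · have := hR _ hmem
    rw [hnorm] at this
    exact (Real.le_log_iff_exp_le (by positivity)).mpr (this.trans (le_max_left _ _))

/-- The weight e^(-σt) replaces ∂ by ∂ + σ in ∂² + (d-2)∂ - n(n+d-2), whose roots n and -(n+d-2)
give the two parameters of the kernel. -/
theorem integral_mul_polyFun_eq_greenKernel {d n : ℕ} {u : EuclideanSpace ℝ (Fin d) → ℂ}
    (hu : ContDiff ℝ (⊤ : ℕ∞) u) (huc : HasCompactSupport u)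
    (hu0 : (0 : EuclideanSpace ℝ (Fin d)) ∉ tsupport u)
    {P : MvPolynomial (Fin d) ℂ} (hP : P ∈ solidHarmonics d n) {σ : ℝ}
    (ha : σ - n ≠ 0) (hb : σ + n + d - 2 ≠ 0) (hab : σ - n ≠ σ + n + d - 2) (t : ℝ) :
    ∫ ω : USphere d, (Real.exp (-(σ * t)) • u (Real.exp t • (ω : EuclideanSpace ℝ (Fin d)))) *
        polyFun P ω ∂(surfaceMeasure d) =
      ∫ s, greenKernel (σ - n) (σ + n + d - 2) (t - s) •
        ∫ ω : USphere d, ((Real.exp (-(σ * s)) * Real.exp s ^ 2) •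
          Laplacian.laplacian u (Real.exp s • (ω : EuclideanSpace ℝ (Fin d)))) *
            polyFun P ω ∂(surfaceMeasure d) := by
  have hPc := (contDiff_polyFun P).continuous
  have hE := hu.fieldDeriv (ContinuousLinearMap.id ℝ _)
  have hEE := hE.fieldDeriv (ContinuousLinearMap.id ℝ _)
  set I : (EuclideanSpace ℝ (Fin d) → ℂ) → ℝ → ℂ := fun w t =>
    ∫ ω : USphere d, w (Real.exp t • (ω : EuclideanSpace ℝ (Fin d))) * polyFun P ω
      ∂(surfaceMeasure d) with hI
  have d0 : ∀ t, HasDerivAt (I u) (I (eulerDeriv u) t) t := hasDerivAt_integral_dilation hu hPc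
  have d1 : ∀ t, HasDerivAt (I (eulerDeriv u)) (I (eulerDeriv (eulerDeriv u)) t) t :=
    hasDerivAt_integral_dilation hE hPc
  have d2 := hasDerivAt_integral_dilation hEE hPc
  have c0 : Continuous (I u) := continuous_iff_continuousAt.mpr fun t => (d0 t).continuousAt
  have c1 : Continuous (I (eulerDeriv u)) :=
    continuous_iff_continuousAt.mpr fun t => (d1 t).continuousAt
  have c2 : Continuous (I (eulerDeriv (eulerDeriv u))) :=
    continuous_iff_continuousAt.mpr fun t => (d2 t).continuousAt
  have hIc : HasCompactSupport (I u) := by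
    refine (hasCompactSupport_expDilate (w := ⟨u, hu.continuous⟩) huc hu0).mono ?_
    intro t ht h
    apply ht
    have h1 : ∀ ω : USphere d, u (Real.exp t • (ω : EuclideanSpace ℝ (Fin d))) = 0 := fun ω =>
      DFunLike.congr_fun h ω
    simp [hI, h1]
  set ex : ℝ → ℝ := fun t => Real.exp (-(σ * t)) with hex
  have hexd : ∀ t, HasDerivAt (fun t => (ex t : ℂ)) (-(σ : ℂ) * ex t) t := by
    intro t
    have h1 : HasDerivAt (fun t => -(σ * t)) (-σ) t := by
      convert! ((hasDerivAt_id t).const_mul σ).neg using 1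
      simp
    convert! h1.exp.ofReal_comp using 1
    simp only [hex]
    push_cast
    ring
  have hexc : Continuous fun t => (ex t : ℂ) := by
    simp only [hex]; fun_prop
  have key := eq_integral_greenKernel ha hb hab
    (φ := fun t => (ex t : ℂ) * I u t)
    (φ' := fun t => (ex t : ℂ) * (I (eulerDeriv u) t - σ * I u t))
    (φ'' := fun t => (ex t : ℂ) * (I (eulerDeriv (eulerDeriv u)) t -
      2 * σ * I (eulerDeriv u) t + σ ^ 2 * I u t))
    (fun t => by
      convert! (hexd t).mul (d0 t) using 1
      ring)
    (fun t => by
      convert! (hexd t).mul ((d1 t).sub ((d0 t).const_mul (σ : ℂ))) using 1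
      simp only [Pi.sub_apply]
      ring)
    (by fun_prop) (hIc.mul_left) t
  have hL : ∀ (c s : ℝ) (w : EuclideanSpace ℝ (Fin d) → ℂ), ∫ ω : USphere d, (c • w (Real.exp s •
      (ω : EuclideanSpace ℝ (Fin d)))) * polyFun P ω ∂(surfaceMeasure d) = (c : ℂ) * I w s := by
    intro c s w
    simp_rw [Complex.real_smul, mul_assoc]
    rw [integral_const_mul]
  rw [hL]
  rw [key]
  congr 1
  ext s
  congr 1
  have h1 := integral_dilation_laplacian hu hP (Real.exp s)
  rw [hL] at h1
  rw [hL]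
  change _ = I (eulerDeriv (eulerDeriv u)) s + ((d : ℂ) - 2) * I (eulerDeriv u) s -
    ((n : ℂ) * (n + d - 2)) * I u s at h1
  -- All terms containing σ cancel, leaving the unconjugated operator times the weight.
  calc _ = (ex s : ℂ) * (I (eulerDeriv (eulerDeriv u)) s + ((d : ℂ) - 2) * I (eulerDeriv u) s -
        ((n : ℂ) * (n + d - 2)) * I u s) := by
        push_cast
        ring
    _ = _ := by
        rw [← h1, Complex.ofReal_mul]
        ring

/-! ### Projection bounds for continuous functions, including degree zero. -/

theorem memLp_sphere {d : ℕ} (f : C(USphere d, ℂ)) (r : ENNReal) : MemLp f r (surfaceMeasure d) := by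
  obtain ⟨C, hC⟩ := (isCompact_univ (X := USphere d)).exists_bound_of_continuousOn
    f.continuous.continuousOn
  exact MemLp.of_bound f.continuous.aestronglyMeasurable C
    (Filter.Eventually.of_forall fun ω => hC ω (Set.mem_univ _))

/-- The class in `L²` of a continuous function on the sphere. -/
abbrev sphereToL2 (d : ℕ) : C(USphere d, ℂ) →L[ℂ] Lp ℂ 2 (surfaceMeasure d) :=
  ContinuousMap.toLp (E := ℂ) 2 (surfaceMeasure d) ℂ

theorem eLpNorm_toLp {d : ℕ} (r : ENNReal) [Fact (1 ≤ r)] (f : C(USphere d, ℂ)) (s : ENNReal) :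
    eLpNorm (ContinuousMap.toLp (E := ℂ) r (surfaceMeasure d) ℂ f) s (surfaceMeasure d) =
      eLpNorm f s (surfaceMeasure d) :=
  eLpNorm_congr_ae (ContinuousMap.coeFn_toLp _ f)

theorem enorm_toLp {d : ℕ} (r : ENNReal) [Fact (1 ≤ r)] (f : C(USphere d, ℂ)) :
    ‖ContinuousMap.toLp (E := ℂ) r (surfaceMeasure d) ℂ f‖ₑ = eLpNorm f r (surfaceMeasure d) := by
  rw [Lp.enorm_def, eLpNorm_toLp]

/-- The bound for the projection on constants. -/
theorem exists_bound_harmonicProj_zero (d : ℕ) {p q : ℝ} (hp : 1 < p) (hq : 0 < q) :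
    ∃ M : ℝ, 0 ≤ M ∧ ∀ f : C(USphere d, ℂ),
      eLpNorm (harmonicProj d 0 (sphereToL2 d f)) (ENNReal.ofReal q) (surfaceMeasure d) ≤
        ENNReal.ofReal M * eLpNorm f (ENNReal.ofReal p) (surfaceMeasure d) := by
  set μ := surfaceMeasure d with hμ
  rcases eq_or_ne μ 0 with h0 | h0
  · refine ⟨0, le_rfl, fun f => ?_⟩
    have : eLpNorm (harmonicProj d 0 (sphereToL2 d f)) (ENNReal.ofReal q) μ = 0 := by
      rw [h0, eLpNorm_measure_zero]
    rw [this]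
    exact zero_le
  set m := μ Set.univ with hm
  have hm0 : m ≠ 0 := by rwa [hm, Ne, Measure.measure_univ_eq_zero]
  have hmt : m ≠ ⊤ := measure_ne_top _ _
  -- The factors come from taking the mean, from Hölder between L¹ and L^p, and from the L^q norm of
  -- a constant.
  set K := m⁻¹ * m ^ (1 - 1 / p) * m ^ (1 / q) with hK
  have hKt : K ≠ ⊤ := by
    refine ENNReal.mul_ne_top (ENNReal.mul_ne_top (ENNReal.inv_ne_top.mpr hm0) ?_) ?_
    · exact ENNReal.rpow_ne_top_of_ne_zero hm0 hmt
    · exact ENNReal.rpow_ne_top_of_ne_zero hm0 hmt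
  refine ⟨K.toReal, ENNReal.toReal_nonneg, fun f => ?_⟩
  rw [ENNReal.ofReal_toReal hKt]
  obtain ⟨P, hP, hPf⟩ := mem_sphericalHarmonics_iff.mp
    (Submodule.starProjection_apply_mem (sphericalHarmonics d 0) (sphereToL2 d f))
  have hP0 : P.IsHomogeneous 0 := hP.1
  rw [← MvPolynomial.totalDegree_zero_iff_isHomogeneous,
    MvPolynomial.totalDegree_eq_zero_iff_eq_C] at hP0
  set a := MvPolynomial.coeff 0 P with ha
  have hPa : ∀ ω : USphere d, restrictToSphere d P ω = a := by
    intro ω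
    rw [restrictToSphere_apply, hP0]
    simp [polyFun]
  have h1 : (1 : MvPolynomial (Fin d) ℂ) ∈ solidHarmonics d 0 := by
    refine ⟨MvPolynomial.isHomogeneous_one _ _, ?_⟩
    change polyLaplacian d 1 = 0
    simp [polyLaplacian_apply]
  have hproj : harmonicProj d 0 (sphereToL2 d f) = sphereToL2 d (restrictToSphere d P) := hPf.symm
  have hint : a * (m.toReal : ℂ) = ∫ ω, f ω ∂μ := by
    have h2 : inner ℂ (sphereToL2 d (restrictToSphere d 1)) (sphereToL2 d f) =
        inner ℂ (sphereToL2 d (restrictToSphere d 1)) (sphereToL2 d (restrictToSphere d P)) := by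
      rw [← hproj]
      have h3 : harmonicProj d 0 (sphereToL2 d (restrictToSphere d 1)) =
          sphereToL2 d (restrictToSphere d 1) :=
        Submodule.starProjection_eq_self_iff.mpr (mem_sphericalHarmonics_iff.mpr ⟨1, h1, rfl⟩)
      conv_lhs => rw [← h3]
      exact Submodule.inner_starProjection_left_eq_right _ _ _
    rw [inner_toLp_restrictToSphere, inner_toLp_restrictToSphere] at h2
    have h4 : ∀ ω : USphere d,
        polyFun (MvPolynomial.map (starRingEnd ℂ) (1 : MvPolynomial (Fin d) ℂ)) ω = 1 := by
      intro ω; simp [polyFun]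
    simp_rw [h4, mul_one, hPa] at h2
    rw [h2, integral_const, Complex.real_smul, mul_comm]
    rfl
  have hnorm : eLpNorm (harmonicProj d 0 (sphereToL2 d f)) (ENNReal.ofReal q) μ =
      ‖a‖ₑ * m ^ (1 / q) := by
    rw [hproj, eLpNorm_toLp]
    have : (restrictToSphere d P : USphere d → ℂ) = fun _ => a := funext hPa
    rw [this, eLpNorm_const' a (by simpa using hq) ENNReal.ofReal_ne_top,
      ENNReal.toReal_ofReal hq.le]
  have ha' : ‖a‖ₑ * m ≤ eLpNorm f (ENNReal.ofReal p) μ * m ^ (1 - 1 / p) := by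
    calc ‖a‖ₑ * m = ‖a * (m.toReal : ℂ)‖ₑ := by
          rw [enorm_mul]
          congr 1
          rw [← ofReal_norm, Complex.norm_of_nonneg ENNReal.toReal_nonneg,
            ENNReal.ofReal_toReal hmt]
      _ ≤ ∫⁻ ω, ‖f ω‖ₑ ∂μ := by
          rw [hint]; exact enorm_integral_le_lintegral_enorm _
      _ = eLpNorm f 1 μ := eLpNorm_one_eq_lintegral_enorm.symm
      _ ≤ _ := by
          have := eLpNorm_le_eLpNorm_mul_rpow_measure_univ (p := 1) (q := ENNReal.ofReal p) (μ := μ)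
            (f := f) (by simpa using hp.le) f.continuous.aestronglyMeasurable
          simpa [ENNReal.toReal_ofReal (by linarith : 0 ≤ p)] using this
  rw [hnorm, hK]
  calc ‖a‖ₑ * m ^ (1 / q) = m⁻¹ * (‖a‖ₑ * m) * m ^ (1 / q) := by
        rw [mul_comm ‖a‖ₑ m, ENNReal.inv_mul_cancel_left hm0 hmt]
    _ ≤ m⁻¹ * (eLpNorm f (ENNReal.ofReal p) μ * m ^ (1 - 1 / p)) * m ^ (1 / q) := by gcongr
    _ = _ := by ring

/-- Passing from n to n + 1 lets one bound cover degree 0, about which the hypothesis says nothing.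
-/
theorem exists_bound_harmonicProj {d : ℕ} (hd : 3 ≤ d) {p q : ℝ} (hp : 1 < p) (hq : 0 < q)
    (hproj : HarmonicProjBound d p q) :
    ∃ A : ℝ, 0 < A ∧ ∀ n, ∀ f : C(USphere d, ℂ),
      eLpNorm (harmonicProj d n (sphereToL2 d f)) (ENNReal.ofReal q) (surfaceMeasure d) ≤
        ENNReal.ofReal (A * ((n : ℝ) + 1) ^ (1 - 2 / (d : ℝ))) *
          eLpNorm f (ENNReal.ofReal p) (surfaceMeasure d) := by
  obtain ⟨A, hA⟩ := hproj
  obtain ⟨M, hM0, hM⟩ := exists_bound_harmonicProj_zero d hp hq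
  have hd' : (3 : ℝ) ≤ d := by exact_mod_cast hd
  have hexp : 0 ≤ 1 - 2 / (d : ℝ) := by
    rw [sub_nonneg, div_le_one (by linarith)]
    linarith
  refine ⟨|A| + M + 1, by positivity, fun n f => ?_⟩
  rcases Nat.eq_zero_or_pos n with rfl | hn
  · refine (hM f).trans ?_
    gcongr
    simp only [Nat.cast_zero, zero_add, Real.one_rpow, mul_one]
    linarith [abs_nonneg A]
  · have h := hA n hn (sphereToL2 d f) (((memLp_sphere f _).ae_eq
      (ContinuousMap.coeFn_toLp _ f).symm))
    rw [eLpNorm_toLp] at h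
    refine h.trans ?_
    gcongr ENNReal.ofReal ?_ * _
    calc A * (n : ℝ) ^ (1 - 2 / (d : ℝ)) ≤ |A| * (n : ℝ) ^ (1 - 2 / (d : ℝ)) := by
          gcongr; exact le_abs_self A
      _ ≤ _ := by
          gcongr <;> linarith

/-! ### Slicewise domination by a Riesz potential. -/

/-- `u` in logarithmic polar coordinates with the weight `e^(-σ t)`, as a continuous family of
continuous functions on the sphere. -/
def weightedDilate {d : ℕ} (e : C(ℝ, ℝ)) (w : C(EuclideanSpace ℝ (Fin d), ℂ)) (t : ℝ) :
    C(USphere d, ℂ) := e t • expDilate w t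

theorem continuous_weightedDilate {d : ℕ} (e : C(ℝ, ℝ)) (w : C(EuclideanSpace ℝ (Fin d), ℂ)) :
    Continuous (weightedDilate e w) := e.continuous.smul (expDilate w).continuous

theorem hasCompactSupport_weightedDilate {d : ℕ} (e : C(ℝ, ℝ))
    {w : C(EuclideanSpace ℝ (Fin d), ℂ)} (hw : HasCompactSupport w)
    (h0 : (0 : EuclideanSpace ℝ (Fin d)) ∉ tsupport w) :
    HasCompactSupport (weightedDilate e w) :=
  (hasCompactSupport_expDilate hw h0).fun_smul_left _

/-- The weight `e^(-σ t)`. -/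
def expWeight (σ : ℝ) : C(ℝ, ℝ) := ⟨fun t => Real.exp (-(σ * t)), by fun_prop⟩

/-- The weight `e^(-σ t) r²` with `r = e^t`. -/
def expWeightSq (σ : ℝ) : C(ℝ, ℝ) := ⟨fun t => Real.exp (-(σ * t)) * Real.exp t ^ 2, by fun_prop⟩

/-- The `n`-th harmonic component of `u` is that of the Green potential of `Δ u`. -/
theorem harmonicProj_weightedDilate {d n : ℕ} {u : EuclideanSpace ℝ (Fin d) → ℂ}
    (hu : ContDiff ℝ (⊤ : ℕ∞) u) (huc : HasCompactSupport u)
    (hu0 : (0 : EuclideanSpace ℝ (Fin d)) ∉ tsupport u)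
    {g : ℝ → C(USphere d, ℂ)} (hgc : Continuous g) (hgs : HasCompactSupport g) {σ : ℝ}
    (hg : ∀ s ω, g s ω = (Real.exp (-(σ * s)) * Real.exp s ^ 2) •
          Laplacian.laplacian u (Real.exp s • (ω : EuclideanSpace ℝ (Fin d))))
    (ha : σ - n ≠ 0) (hb : σ + n + d - 2 ≠ 0) (hab : σ - n ≠ σ + n + d - 2) (t : ℝ) :
    harmonicProj d n (sphereToL2 d (weightedDilate (expWeight σ) ⟨u, hu.continuous⟩ t)) =
      harmonicProj d n (sphereToL2 d
        (∫ s, greenKernel (σ - n) (σ + n + d - 2) (t - s) • g s)) := by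
  rw [← sub_eq_zero, ← map_sub]
  -- It suffices that the difference is orthogonal to every harmonic of degree n; pairing with one
  -- is a continuous functional, so it passes through the integral and leaves the scalar formula.
  refine (Submodule.starProjection_apply_eq_zero_iff _).mpr ?_
  intro y hy
  obtain ⟨P, hP, rfl⟩ := mem_sphericalHarmonics_iff.mp hy
  rw [inner_sub_right, sub_eq_zero]
  have hint := integrable_greenKernel_smul hgc hgs (σ - n) (σ + n + d - 2) t
  set L : C(USphere d, ℂ) →L[ℂ] ℂ :=
    (innerSL ℂ (sphereToL2 d (restrictToSphere d P))).comp (sphereToL2 d) with hL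
  change L _ = L _
  rw [← L.integral_comp_comm hint]
  have hLf : ∀ f : C(USphere d, ℂ), L f =
      ∫ ω : USphere d, f ω * polyFun (MvPolynomial.map (starRingEnd ℂ) P) ω
      ∂(surfaceMeasure d) := fun f => inner_toLp_restrictToSphere P f
  have hLs : ∀ (c : ℝ) (f : C(USphere d, ℂ)), L (c • f) = c • L f := fun c f =>
    L.map_smul_of_tower c f
  simp_rw [hLs, hLf, hg]
  exact integral_mul_polyFun_eq_greenKernel hu huc hu0 (map_conj_mem_solidHarmonics hP) ha hb hab t

/-- Minkowski's integral inequality: the continuous map into L^p commutes with the Bochner integral.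
-/
theorem eLpNorm_integral_smul_le {d : ℕ} {p : ℝ} (hp : 1 ≤ p) {g : ℝ → C(USphere d, ℂ)}
    {k : ℝ → ℝ} (hint : Integrable fun s => k s • g s) :
    eLpNorm (∫ s, k s • g s : C(USphere d, ℂ)) (ENNReal.ofReal p) (surfaceMeasure d) ≤
      ∫⁻ s, ENNReal.ofReal |k s| * eLpNorm (g s) (ENNReal.ofReal p) (surfaceMeasure d) := by
  have : Fact (1 ≤ ENNReal.ofReal p) := ⟨by simpa using hp⟩
  set L := ContinuousMap.toLp (E := ℂ) (ENNReal.ofReal p) (surfaceMeasure d) ℂ with hL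
  rw [← enorm_toLp, ← L.integral_comp_comm hint]
  refine (enorm_integral_le_lintegral_enorm _).trans (le_of_eq ?_)
  refine lintegral_congr fun s => ?_
  rw [L.map_smul_of_tower, enorm_smul, enorm_toLp, Real.enorm_eq_ofReal_abs]

/-- The expansion converges in L², hence in measure, and the L^q norm is lower semicontinuous for
that; no convergence in L^q is needed. -/
theorem eLpNorm_le_of_harmonicProj {d : ℕ} (hd : 2 ≤ d) (f : C(USphere d, ℂ)) (q : ENNReal)
    {B : ENNReal} (hB : ∀ N, ∑ n ∈ Finset.range N,
      eLpNorm (harmonicProj d n (sphereToL2 d f)) q (surfaceMeasure d) ≤ B) (hq : 1 ≤ q) :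
    eLpNorm f q (surfaceMeasure d) ≤ B := by
  rw [← eLpNorm_toLp 2 f]
  have hs := (hasSum_harmonicProj hd (sphereToL2 d f)).tendsto_sum_nat
  refine eLpNorm_le_of_tendstoInMeasure (Filter.Eventually.of_forall fun N => ?_)
    (tendstoInMeasure_of_tendsto_Lp hs) fun N => Lp.aestronglyMeasurable _
  refine le_trans ?_ (hB N)
  rw [eLpNorm_congr_ae (Lp.coeFn_finsetSum _ _)]
  exact eLpNorm_sum_le (fun n _ => Lp.aestronglyMeasurable _) hq

/-- Summed Green kernels are dominated by the Riesz kernel, uniformly in `σ` at distance at least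
`c` from the integers. -/
theorem sum_greenKernel_le {d : ℕ} (hd : 3 ≤ d) {c σ x : ℝ} (hc : 0 < c)
    (hσ : ∀ n : ℤ, c ≤ |σ - n|) (hx : x ≠ 0) (N : ℕ) :
    ∑ n ∈ Finset.range N, ((n : ℝ) + 1) ^ (1 - 2 / (d : ℝ)) *
        |greenKernel (σ - n) (σ + n + d - 2) x| ≤
      2 * (1 / (1 - 2 / (d : ℝ)) + 2 / min c (1 / 4)) * |x| ^ (2 / (d : ℝ) - 1) := by
  have hd' : (3 : ℝ) ≤ d := by exact_mod_cast hd
  have hβ0 : 0 < 2 / (d : ℝ) := by positivity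
  have hβ1 : 2 / (d : ℝ) < 1 := by rw [div_lt_one (by linarith)]; linarith
  have hx0 : 0 < |x| := abs_pos.mpr hx
  -- The reflection writes |σ + n + d - 2| as |σ' - n|; as d - 2 is an integer, σ' keeps the same
  -- gap from the integers.
  set σ' : ℝ := -(σ + d - 2) with hσ'
  have hσ'n : ∀ n : ℤ, c ≤ |σ' - n| := by
    intro n
    have h := hσ (-(n + d - 2))
    rw [← abs_neg] at h
    convert h using 2
    rw [hσ']
    push_cast
    ring
  have hterm : ∀ n : ℕ, ((n : ℝ) + 1) ^ (1 - 2 / (d : ℝ)) *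
        |greenKernel (σ - n) (σ + n + d - 2) x| ≤
      ((n : ℝ) + 1) ^ (-(2 / (d : ℝ))) * Real.exp (-(|σ - n| * |x|)) +
        ((n : ℝ) + 1) ^ (-(2 / (d : ℝ))) * Real.exp (-(|σ' - n| * |x|)) := by
    intro n
    have hn : (0 : ℝ) < (n : ℝ) + 1 := by positivity
    have hn0 : (0 : ℝ) ≤ n := Nat.cast_nonneg n
    have h1 : |σ + n + d - 2| = |σ' - n| := by
      rw [hσ', ← abs_neg]; congr 1; ring
    have h2 := abs_greenKernel_le (a := σ - n) (b := σ + n + d - 2) (by linarith) x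
    rw [h1] at h2
    -- The root gap is 2n + d - 2, at least n + 1 since d ≥ 3. Dividing by it turns the exponent 1 -
    -- 2/d into -2/d.
    have h3 : (n : ℝ) + 1 ≤ σ + n + d - 2 - (σ - n) := by linarith
    have h4 : ((n : ℝ) + 1) ^ (1 - 2 / (d : ℝ)) =
        ((n : ℝ) + 1) * ((n : ℝ) + 1) ^ (-(2 / (d : ℝ))) := by
      rw [sub_eq_add_neg, Real.rpow_add hn, Real.rpow_one]
    set e := Real.exp (-(|σ - n| * |x|)) + Real.exp (-(|σ' - n| * |x|)) with he
    have he0 : 0 < e := by positivity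
    calc _ ≤ ((n : ℝ) + 1) ^ (1 - 2 / (d : ℝ)) * (e / ((n : ℝ) + 1)) := by
          gcongr
          exact h2.trans (by gcongr)
      _ = ((n : ℝ) + 1) ^ (-(2 / (d : ℝ))) * e := by
          rw [h4]; field_simp
      _ = _ := by rw [he, mul_add]
  refine (Finset.sum_le_sum fun n _ => hterm n).trans ?_
  rw [Finset.sum_add_distrib]
  have e1 := sum_rpow_mul_exp_le hβ0 hβ1 hc hσ hx0 N
  have e2 := sum_rpow_mul_exp_le hβ0 hβ1 hc hσ'n hx0 N
  linarith

/-- On each sphere, `u` is controlled by the Riesz potential of the norms of `Δ u`. -/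
theorem exists_bound_weightedDilate {d : ℕ} (hd : 3 ≤ d) {p q : ℝ} (hp : 1 < p) (hq : 1 < q)
    (hproj : HarmonicProjBound d p q) {c : ℝ} (hc : 0 < c) :
    ∃ C : ℝ, 0 < C ∧ ∀ σ : ℝ, (∀ n : ℤ, c ≤ |σ - n|) →
      ∀ (u : EuclideanSpace ℝ (Fin d) → ℂ) (hu : ContDiff ℝ (⊤ : ℕ∞) u),
        HasCompactSupport u → (0 : EuclideanSpace ℝ (Fin d)) ∉ tsupport u →
        ∀ g : ℝ → C(USphere d, ℂ), Continuous g → HasCompactSupport g →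
        (∀ s ω, g s ω = (Real.exp (-(σ * s)) * Real.exp s ^ 2) •
          Laplacian.laplacian u (Real.exp s • (ω : EuclideanSpace ℝ (Fin d)))) →
        ∀ t, eLpNorm (weightedDilate (expWeight σ) ⟨u, hu.continuous⟩ t) (ENNReal.ofReal q)
            (surfaceMeasure d) ≤
          ∫⁻ s, ENNReal.ofReal (|t - s| ^ (2 / (d : ℝ) - 1)) *
            (ENNReal.ofReal C * eLpNorm (g s) (ENNReal.ofReal p) (surfaceMeasure d)) := by
  obtain ⟨A, hA, hbound⟩ := exists_bound_harmonicProj hd hp (by linarith) hproj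
  have hd' : (3 : ℝ) ≤ d := by exact_mod_cast hd
  have hβ1 : 0 < 1 - 2 / (d : ℝ) := by
    rw [sub_pos, div_lt_one (by linarith)]; linarith
  set C₀ := 2 * (1 / (1 - 2 / (d : ℝ)) + 2 / min c (1 / 4)) with hC₀
  have hC₀0 : 0 < C₀ := by positivity
  refine ⟨A * C₀, by positivity, ?_⟩
  intro σ hσ u hu huc hu0 g hgc hgs hg t
  have hne : ∀ n : ℤ, σ - n ≠ 0 := fun n h => by
    have := hσ n
    rw [h, abs_zero] at this
    linarith
  refine eLpNorm_le_of_harmonicProj (by omega) _ _ (fun N => ?_) (by simpa using hq.le)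
  have hgm : Measurable fun s => eLpNorm (g s) (ENNReal.ofReal p) (surfaceMeasure d) := by
    have : Fact (1 ≤ ENNReal.ofReal p) := ⟨by simpa using hp.le⟩
    simp_rw [← enorm_toLp]
    exact ((ContinuousLinearMap.continuous _).comp hgc).enorm.measurable
  have hKm : ∀ n : ℕ, Measurable fun s => ENNReal.ofReal (A * ((n : ℝ) + 1) ^ (1 - 2 / (d : ℝ)) *
      |greenKernel (σ - n) (σ + n + d - 2) (t - s)|) := by
    intro n
    have : Measurable fun s => greenKernel (σ - n) (σ + n + d - 2) (t - s) :=
      (measurable_greenKernel _ _).comp (by fun_prop)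
    exact (this.abs.const_mul _).ennreal_ofReal
  calc _ ≤ ∑ n ∈ Finset.range N, ∫⁻ s, ENNReal.ofReal (A * ((n : ℝ) + 1) ^ (1 - 2 / (d : ℝ)) *
          |greenKernel (σ - n) (σ + n + d - 2) (t - s)|) *
            eLpNorm (g s) (ENNReal.ofReal p) (surfaceMeasure d) := by
        refine Finset.sum_le_sum fun n _ => ?_
        have hb : σ + n + d - 2 ≠ 0 := by
          have := hne (-(n + d - 2))
          push_cast at this
          intro h
          apply this
          linarith
        have hn0 : (0 : ℝ) ≤ n := Nat.cast_nonneg n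
        have hab : σ - n ≠ σ + n + d - 2 := by
          apply ne_of_lt
          linarith
        rw [harmonicProj_weightedDilate hu huc hu0 hgc hgs hg (by exact_mod_cast hne n) hb hab t]
        refine (hbound n _).trans ?_
        refine (mul_le_mul_right (eLpNorm_integral_smul_le hp.le
          (integrable_greenKernel_smul hgc hgs _ _ t)) _).trans (le_of_eq ?_)
        rw [← lintegral_const_mul']
        · refine lintegral_congr fun s => ?_
          rw [← mul_assoc, ← ENNReal.ofReal_mul (by positivity)]
        · exact ENNReal.ofReal_ne_top
    _ = ∫⁻ s, ∑ n ∈ Finset.range N, ENNReal.ofReal (A * ((n : ℝ) + 1) ^ (1 - 2 / (d : ℝ)) *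
          |greenKernel (σ - n) (σ + n + d - 2) (t - s)|) *
            eLpNorm (g s) (ENNReal.ofReal p) (surfaceMeasure d) :=
        (lintegral_finsetSum _ fun n _ => (hKm n).mul hgm).symm
    _ ≤ _ := by
        refine lintegral_mono_ae ?_
        have hae : ∀ᵐ s : ℝ, s ≠ t := by
          simp [ae_iff, measure_singleton]
        filter_upwards [hae] with s hs
        rw [← Finset.sum_mul, ← ENNReal.ofReal_sum_of_nonneg (fun n _ => by positivity), ← mul_assoc,
          ← ENNReal.ofReal_mul (by positivity)]
        gcongr
        simp_rw [mul_assoc A]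
        rw [← Finset.mul_sum]
        have := sum_greenKernel_le hd hc hσ (sub_ne_zero.mpr hs.symm) N
        rw [← hC₀] at this
        calc _ ≤ A * (C₀ * |t - s| ^ (2 / (d : ℝ) - 1)) := by gcongr
          _ = _ := by ring

/-! ### Weighted norms in logarithmic polar coordinates. -/

/-- Polar coordinates with logarithmic radius. -/
theorem lintegral_eq_lintegral_exp_sphere {d : ℕ} (hd : 1 ≤ d)
    {f : EuclideanSpace ℝ (Fin d) → ENNReal} (hf : Measurable f) :
    ∫⁻ x, f x = ∫⁻ t : ℝ, ∫⁻ ω : USphere d, ENNReal.ofReal (Real.exp t ^ d) *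
      f (Real.exp t • (ω : EuclideanSpace ℝ (Fin d))) ∂(surfaceMeasure d) := by
  have : Nontrivial (EuclideanSpace ℝ (Fin d)) := by
    have : Nonempty (Fin d) := ⟨⟨0, hd⟩⟩
    infer_instance
  have hmp := (volume : Measure (EuclideanSpace ℝ (Fin d))).measurePreserving_homeomorphUnitSphereProd
  have hrank : Module.finrank ℝ (EuclideanSpace ℝ (Fin d)) = d := by simp
  rw [hrank] at hmp
  set F : USphere d × Set.Ioi (0 : ℝ) → ENNReal :=
    fun x => f ((x.2 : ℝ) • (x.1 : EuclideanSpace ℝ (Fin d))) with hF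
  have hFm : Measurable F := hf.comp (by fun_prop)
  have h1 : ∫⁻ x, f x = ∫⁻ x : ({0}ᶜ : Set (EuclideanSpace ℝ (Fin d))), f x
      ∂(Measure.comap Subtype.val volume) := by
    rw [lintegral_subtype_comap (measurableSet_singleton _).compl, restrict_compl_singleton]
  have h2 : ∀ x : ({0}ᶜ : Set (EuclideanSpace ℝ (Fin d))),
      f x = F (homeomorphUnitSphereProd _ x) := by
    intro x
    simp only [hF]
    congr 1
    have hx : ‖(x : EuclideanSpace ℝ (Fin d))‖ ≠ 0 := norm_ne_zero_iff.mpr x.2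
    simp [smul_smul, hx]
  rw [h1]
  simp_rw [h2]
  rw [hmp.lintegral_comp hFm, lintegral_prod_symm' _ hFm, Measure.volumeIoiPow,
    lintegral_withDensity_eq_lintegral_mul _ (by fun_prop) hFm.lintegral_prod_left']
  have h3 := lintegral_subtype_comap (μ := (volume : Measure ℝ)) (measurableSet_Ioi (a := (0 : ℝ)))
    (fun r : ℝ => ENNReal.ofReal (r ^ (d - 1)) * ∫⁻ ω : USphere d,
      f (r • (ω : EuclideanSpace ℝ (Fin d))) ∂(surfaceMeasure d))
  refine h3.trans ?_
  -- The substitution r = e^t contributes one more factor e^t, raising r^(d-1) to e^(td).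
  rw [← Real.range_exp, ← Set.image_univ, lintegral_image_eq_lintegral_abs_deriv_mul
    MeasurableSet.univ (fun t _ => (Real.hasDerivAt_exp t).hasDerivWithinAt)
    Real.exp_injective.injOn, Measure.restrict_univ]
  refine lintegral_congr fun t => ?_
  have hm : Measurable fun ω : USphere d => f (Real.exp t • (ω : EuclideanSpace ℝ (Fin d))) :=
    hf.comp (by fun_prop)
  rw [lintegral_const_mul _ hm, ← mul_assoc, ← ENNReal.ofReal_mul (abs_nonneg _),
    abs_of_pos (Real.exp_pos _), ← pow_succ', Nat.sub_add_cancel hd]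

/-- Weighted `L^r` norms on `ℝ^d` in logarithmic polar coordinates. -/
theorem eLpNorm_weighted_eq {d : ℕ} (hd : 1 ≤ d) {r : ℝ} (hr : 1 ≤ r) (τ : ℝ)
    (w : C(EuclideanSpace ℝ (Fin d), ℂ)) (e : C(ℝ, ℝ))
    (he : ∀ t, e t = Real.exp ((-τ + d / r) * t)) :
    eLpNorm (fun x => (‖x‖ ^ (-τ) : ℝ) • w x) (ENNReal.ofReal r) volume =
      (∫⁻ t, eLpNorm (weightedDilate e w t) (ENNReal.ofReal r) (surfaceMeasure d) ^ r) ^ (1 / r) := by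
  have hr0 : 0 < r := by linarith
  have hr1 : ENNReal.ofReal r ≠ 0 := by simpa using hr0
  have hm : Measurable fun x : EuclideanSpace ℝ (Fin d) => ‖(‖x‖ ^ (-τ) : ℝ) • w x‖ₑ ^ r := by
    fun_prop
  rw [eLpNorm_eq_lintegral_rpow_enorm_toReal hr1 ENNReal.ofReal_ne_top,
    ENNReal.toReal_ofReal hr0.le, lintegral_eq_lintegral_exp_sphere hd hm]
  congr 1
  refine lintegral_congr fun t => ?_
  rw [eLpNorm_eq_lintegral_rpow_enorm_toReal hr1 ENNReal.ofReal_ne_top,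
    ENNReal.toReal_ofReal hr0.le, ← ENNReal.rpow_mul, one_div_mul_cancel hr0.ne', ENNReal.rpow_one]
  refine lintegral_congr fun ω => ?_
  have hnorm : ‖Real.exp t • (ω : EuclideanSpace ℝ (Fin d))‖ = Real.exp t := by
    simp [norm_smul]
  have hval : weightedDilate e w t ω = e t • w (Real.exp t • (ω : EuclideanSpace ℝ (Fin d))) := rfl
  rw [hnorm, hval, enorm_smul, enorm_smul, ENNReal.mul_rpow_of_nonneg _ _ hr0.le,
    ENNReal.mul_rpow_of_nonneg _ _ hr0.le, ← mul_assoc, he,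
    Real.enorm_eq_ofReal (by positivity), Real.enorm_eq_ofReal (by positivity),
    ENNReal.ofReal_rpow_of_pos (by positivity), ENNReal.ofReal_rpow_of_pos (by positivity),
    ← ENNReal.ofReal_mul (by positivity)]
  congr 2
  rw [← Real.exp_mul, ← Real.exp_mul, ← Real.exp_nat_mul, ← Real.exp_mul, ← Real.exp_add]
  congr 1
  field_simp
  ring

end

/-! ### Assembly of the Carleman inequality. -/

theorem proposition5p1 (d : ℕ) (hd : 3 ≤ d) (p q : ℝ) (hp : 1 < p) (hq : 1 < q)
    (hpq : 1 / p - 1 / q = 2 / (d : ℝ))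
    (hproj : HarmonicProjBound d p q) :
    ∀ c : ℝ, 0 < c → ∃ C : ℝ, 0 < C ∧ ∀ τ : ℝ,
      c ≤ Metric.infDist τ (Set.range fun k : ℤ => (k : ℝ) + (d : ℝ) / q) →
        CarlemanEstimate d p q τ C := by
  intro c hc
  have hd0 : (0 : ℝ) < d := by
    have : 0 < d := by omega
    exact_mod_cast this
  obtain ⟨C₁, hC₁, h1⟩ := exists_bound_weightedDilate hd hp hq hproj hc
  obtain ⟨C₂, hC₂, h2⟩ := hls hp (by linarith) (by positivity) hpq
  refine ⟨C₂ * C₁, by positivity, ?_⟩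
  intro τ hτ u hu huc hu0
  -- The shift d/q is the Jacobian's share in the L^q norm; the gap of τ from ℤ + d/q becomes that
  -- of σ from ℤ.
  set σ := τ - d / q with hσ
  have hσn : ∀ n : ℤ, c ≤ |σ - n| := by
    intro n
    refine hτ.trans ((Metric.infDist_le_dist_of_mem (Set.mem_range_self n)).trans (le_of_eq ?_))
    rw [Real.dist_eq, hσ]
    congr 1
    ring
  set v := weightedDilate (d := d) (expWeight σ) ⟨u, hu.continuous⟩ with hv
  have hΔc : Continuous (Laplacian.laplacian u : EuclideanSpace ℝ (Fin d) → ℂ) :=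
    hu.laplacian_smooth.continuous
  have hΔsub : tsupport (Laplacian.laplacian u : EuclideanSpace ℝ (Fin d) → ℂ) ⊆ tsupport u := by
    have h := (tsupport_fderiv_subset ℝ (f := fderiv ℝ u)).trans (tsupport_fderiv_subset ℝ)
    refine (closure_minimal ?_ (isClosed_tsupport _))
    intro x hx
    by_contra hcon
    apply hx
    have h0 : fderiv ℝ (fderiv ℝ u) x = 0 := image_eq_zero_of_notMem_tsupport fun h' => hcon (h h')
    rw [laplacian_eq_sum, h0]
    simp
  have hΔcs : HasCompactSupport (Laplacian.laplacian u : EuclideanSpace ℝ (Fin d) → ℂ) :=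
    huc.of_isClosed_subset (isClosed_tsupport _) hΔsub
  set g := weightedDilate (d := d) (expWeightSq σ) ⟨Laplacian.laplacian u, hΔc⟩ with hg
  have hgc : Continuous g := continuous_weightedDilate _ _
  have hgs : HasCompactSupport g :=
    hasCompactSupport_weightedDilate _ hΔcs fun h => hu0 (hΔsub h)
  have key := h1 σ hσn u hu huc hu0 g hgc hgs fun s ω => rfl
  have fp : Fact (1 ≤ ENNReal.ofReal p) := ⟨by simpa using hp.le⟩
  have fq : Fact (1 ≤ ENNReal.ofReal q) := ⟨by simpa using hq.le⟩
  set F : ℝ → ℝ := fun t =>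
    ‖ContinuousMap.toLp (E := ℂ) (ENNReal.ofReal q) (surfaceMeasure d) ℂ (v t)‖ with hF
  set G : ℝ → ℝ := fun s => C₁ *
    ‖ContinuousMap.toLp (E := ℂ) (ENNReal.ofReal p) (surfaceMeasure d) ℂ (g s)‖ with hG
  have hFe : ∀ t, ENNReal.ofReal (F t) = eLpNorm (v t) (ENNReal.ofReal q) (surfaceMeasure d) := by
    intro t
    rw [hF, ofReal_norm, enorm_toLp]
  have hGe : ∀ s, ENNReal.ofReal (G s) =
      ENNReal.ofReal C₁ * eLpNorm (g s) (ENNReal.ofReal p) (surfaceMeasure d) := by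
    intro s
    rw [hG, ENNReal.ofReal_mul hC₁.le, ofReal_norm, enorm_toLp]
  have hGc : Continuous G :=
    continuous_const.mul ((ContinuousLinearMap.continuous _).comp hgc).norm
  have hFc : Continuous F :=
    ((ContinuousLinearMap.continuous _).comp (continuous_weightedDilate _ _)).norm
  have hHLS := h2 G (fun s => by positivity) hGc.measurable F (fun t => by positivity)
    hFc.measurable fun t => by
      rw [hFe]
      simp_rw [hGe]
      exact key t
  have hu' := eLpNorm_weighted_eq (d := d) (by omega) hq.le τ ⟨u, hu.continuous⟩ (expWeight σ)
    (fun t => by simp only [expWeight, ContinuousMap.coe_mk]; congr 1; rw [hσ]; ring)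
  have hΔ' := eLpNorm_weighted_eq (d := d) (by omega) hp.le τ ⟨Laplacian.laplacian u, hΔc⟩ (expWeightSq σ)
    (fun t => by
      simp only [expWeightSq, ContinuousMap.coe_mk]
      rw [← Real.exp_nat_mul, ← Real.exp_add]
      congr 1
      -- The scaling relation makes the L^p weight of Δu equal to e^(-σt) e^(2t), the weight the ODE
      -- produces.
      have : (d : ℝ) / p = d / q + 2 := by
        have h3 : 1 / p = 1 / q + 2 / d := by linarith
        rw [div_eq_mul_one_div, h3]
        field_simp
      rw [hσ, this]
      push_cast
      ring)
  have hq0 : 0 ≤ q := by linarith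
  have hp0 : 0 ≤ p := by linarith
  refine le_trans (le_of_eq hu') ?_
  calc _ = (∫⁻ t, ENNReal.ofReal (F t ^ q)) ^ (1 / q) := by
        congr 1
        refine lintegral_congr fun t => ?_
        rw [← ENNReal.ofReal_rpow_of_nonneg (by positivity) hq0, hFe]
    _ ≤ _ := hHLS
    _ = ENNReal.ofReal C₂ * (ENNReal.ofReal C₁ * (∫⁻ s, eLpNorm (g s) (ENNReal.ofReal p)
          (surfaceMeasure d) ^ p) ^ (1 / p)) := by
        congr 1
        have h4 : ∀ s, ENNReal.ofReal (G s ^ p) = ENNReal.ofReal C₁ ^ p *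
            eLpNorm (g s) (ENNReal.ofReal p) (surfaceMeasure d) ^ p := by
          intro s
          rw [← ENNReal.ofReal_rpow_of_nonneg (by positivity) hp0, hGe,
            ENNReal.mul_rpow_of_nonneg _ _ hp0]
        simp_rw [h4]
        rw [lintegral_const_mul' _ _ (ENNReal.rpow_ne_top_of_nonneg hp0 ENNReal.ofReal_ne_top),
          ENNReal.mul_rpow_of_nonneg _ _ (by positivity), ← ENNReal.rpow_mul,
          mul_one_div_cancel (by linarith), ENNReal.rpow_one]
    _ = ENNReal.ofReal (C₂ * C₁) * (∫⁻ s, eLpNorm (g s) (ENNReal.ofReal p)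
          (surfaceMeasure d) ^ p) ^ (1 / p) := by
        rw [← mul_assoc, ENNReal.ofReal_mul hC₂.le]
    _ = _ := by rw [← hΔ']; rfl
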